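/- **Setting.** Let $I=I_0\sqcup I_1$ be the finite vertex set and $\Omega$ the finite set of arrows of a bipartite quiver whose arrows $h$ all go from a source $s(h)\in I_1$ to a sink $t(h)\in I_0$ (multiple arrows are allowed). Let $w=(w_i,w_i')_{i\in I}$ and $v=(v_i)_{i\in I}$ have entries in $\mathbb Z_{\ge 0}$, and let $W_i=\mathbb C^{w_i}$, $W'_i=\mathbb C^{w'_i}$. Let $\mathbf E_w$ be the affine space of tuples $(x_i,y_h)_{i\in I,h\in\Omega}$ of linear maps $x_\alpha:W'_\alpha\to W_\alpha$ ($\alpha\in I_0$), $x_\beta:W_\beta\to W'_\beta$ ($\beta\in I_1$), $y_h:W_{s(h)}\to W_{t(h)}$. Such a tuple determines the linear maps $$A_\alpha=x_\alpha+\sum_{t(h)=\alpha}y_h:\ W'_\alpha\oplus\bigoplus_{t(h)=\alpha}W_{s(h)}\to W_\alpha\ (\alpha\in I_0),\qquad A_\beta=\Big(x_\beta,(y_h)_{s(h)=\beta}\Big):\ W_\beta\to W'_\beta\oplus\bigoplus_{s(h)=\beta}W_{t(h)}\ (\beta\in I_1).$$ Define the varieties (all complex varieties, with reduced structure) $$\mathbf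 E_{v,w}=\{(x_i,y_h)\in\mathbf E_w:\operatorname{rank}A_i\le v_i\ \forall i\in I\},\qquad \mathbf E^\circ_{v,w}=\{(x_i,y_h)\in\mathbf E_w:\operatorname{rank}A_i=v_i\ \forall i\in I\},$$ let $\mathcal F_{v,w}$ be the variety of tuples $(X_i)_{i\in I}$ of linear subspaces with $\dim X_i=v_i$ for all $i$, $X_\alpha\subseteq W_\alpha$ for $\alpha\in I_0$ and $X_\beta\subseteq W'_\beta\oplus\bigoplus_{s(h)=\beta}X_{t(h)}$ for $\beta\in I_1$ (a closed subvariety of a product of Grassmannians), and let $$\tilde{\mathcal F}_{v,w}=\{(x_i,y_h,X_i)\in\mathbf E_w\times\mathcal F_{v,w}:\operatorname{im}A_i\subseteq X_i\ \forall i\in I\},\qquad \pi:\tilde{\mathcal F}_{v,w}\to\mathbf E_{v,w},\ (x_i,y_h,X_i)\mapsto(x_i,y_h).$$ Put $C_qv=(u_i,u_i')_{i\in I}$ with $u_i=v_i$ and $u'_i=v_i-\sum_{h}v_j$, the sum being over all arrows $h$ with an endpoint $i$, where $j$ is the other endpoint of $h$. Dimension vectors are compared componentwise, and $\mathbb C^*$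 acts on $\mathbf E_w$ by multiplying all $x_i,y_h$ by the same scalar. **Lemma 4.3 (Algebraic Transversal Slice Theorem).** Let $p\in\mathbf E_{v,w}$ be a point of the stratum $\mathbf E^\circ_{v^0,w}$. Then $v^0\le v$, and $w^\perp:=w-C_qv^0$ has nonnegative entries. Put $v^\perp:=v-v^0$ and $U^\perp:=\mathbf E_{v^\perp,w^\perp}$, so that $\pi^{-1}(U^\perp)=\tilde{\mathcal F}_{v^\perp,w^\perp}$. There exist $\mathbb C^*$-invariant Zariski open neighborhoods $U$ of $p$ in $\mathbf E_{v,w}$ and $U^0$ of $p$ in $\mathbf E^\circ_{v^0,w}$, and isomorphisms of varieties $$\varphi:\pi^{-1}(U)\xrightarrow{\ \cong\ }U^0\times\pi^{-1}(U^\perp),\qquad \psi:U\xrightarrow{\ \cong\ }U^0\times U^\perp,$$ such that $\psi\circ\pi=(1\times\pi)\circ\varphi$ on $\pi^{-1}(U)$, $\psi(p)=(p,0)$, and $$\psi\big(\mathbf E^\circ_{u,w}\cap U\big)=U^0\times\mathbf E^\circ_{u-v^0,\,w^\perp}\qquad\text{for every }u\text{ with }v^0\le u\le v.$$ -/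

import Mathlib

/-! ### Classical varieties as spaces with functions -/

/-- A space with functions over `ℂ`: a topological space together with a sheaf of `ℂ`-algebras of
`ℂ`-valued functions in which a function without zeros is invertible and has open non-vanishing
locus.  The sheaf is recorded by the predicate `RegularAt f x`; it only depends on the germ of `f`
at `x`, and the regular functions on an open set `U` are the functions regular at all points
of `U`.  Complex algebraic varieties (sets of closed points with their Zariski topology and their
regular functions) are such spaces, and a morphism of varieties is the same thing as a morphism of
spaces with functions. The topology is deliberately not a `TopologicalSpace` instance: on `ℂ`, on
products and so on it differs from the usual one. -/
class SpaceWithFunctions (X : Type*) where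
  zariski : TopologicalSpace X
  RegularAt : (X → ℂ) → X → Prop
  const : ∀ (c : ℂ) (x : X), RegularAt (fun _ => c) x
  add : ∀ {f g : X → ℂ} {x : X}, RegularAt f x → RegularAt g x →
    RegularAt (fun y => f y + g y) x
  mul : ∀ {f g : X → ℂ} {x : X}, RegularAt f x → RegularAt g x →
    RegularAt (fun y => f y * g y) x
  inv : ∀ {f : X → ℂ} {x : X}, RegularAt f x → f x ≠ 0 → RegularAt (fun y => (f y)⁻¹) x
  congr : ∀ {f g : X → ℂ} {x : X}, RegularAt f x →
    (∃ V, zariski.IsOpen V ∧ x ∈ V ∧ ∀ y ∈ V, f y = g y) → RegularAt g x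
  spread : ∀ {f : X → ℂ} {x : X}, RegularAt f x →
    ∃ V, zariski.IsOpen V ∧ x ∈ V ∧ ∀ y ∈ V, RegularAt f y
  ne_zero : ∀ {f : X → ℂ} {x : X}, RegularAt f x → f x ≠ 0 →
    ∃ V, zariski.IsOpen V ∧ x ∈ V ∧ ∀ y ∈ V, f y ≠ 0

namespace SpaceWithFunctions

/-- Zariski open sets. -/
def IsZariskiOpen {X : Type*} [S : SpaceWithFunctions X] (U : Set X) : Prop :=
  S.zariski.IsOpen U

/-- `f` is a regular function on the set `U`. -/
def RegularOn {X : Type*} [SpaceWithFunctions X] (f : X → ℂ) (U : Set X) : Prop :=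
  ∀ x ∈ U, RegularAt f x

/-- Morphisms: continuous maps that pull regular functions back to regular functions. -/
structure IsMorphism {X Y : Type*} [SpaceWithFunctions X] [SpaceWithFunctions Y]
    (f : X → Y) : Prop where
  continuous : ∀ V : Set Y, IsZariskiOpen V → IsZariskiOpen (f ⁻¹' V)
  regular : ∀ (g : Y → ℂ) (x : X), RegularAt g (f x) → RegularAt (fun z => g (f z)) x

/-- Isomorphisms: bijections that are morphisms in both directions. -/
structure Iso (X Y : Type*) [SpaceWithFunctions X] [SpaceWithFunctions Y] extends X ≃ Y where
  isMorphism_toFun : IsMorphism toFun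
  isMorphism_invFun : IsMorphism invFun

/-- Finite sums and products of functions of a family `B` of locally defined functions.  Here
`Basic B V f` means that `f` is defined on `V` by such an expression. -/
inductive Basic {X : Type*} (B : Set (Set X × (X → ℂ))) : Set X → (X → ℂ) → Prop
  | of {V : Set X} {f : X → ℂ} : (V, f) ∈ B → Basic B V f
  | const (c : ℂ) : Basic B Set.univ (fun _ => c)
  | add {V V' : Set X} {f g : X → ℂ} : Basic B V f → Basic B V' g →
      Basic B (V ∩ V') (fun y => f y + g y)
  | mul {V V' : Set X} {f g : X → ℂ} : Basic B V f → Basic B V' g →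
      Basic B (V ∩ V') (fun y => f y * g y)

/-- The topology with basis the sets `{x ∈ V | f x ≠ 0}`, where `f` is a sum of products of
functions of `B` and is defined on `V`. -/
@[reducible]
def genTop {X : Type*} (B : Set (Set X × (X → ℂ))) : TopologicalSpace X :=
  TopologicalSpace.generateFrom {S | ∃ V f, Basic B V f ∧ S = {x | x ∈ V ∧ f x ≠ 0}}

theorem genTop_basic {X : Type*} {B : Set (Set X × (X → ℂ))} {V : Set X} {f : X → ℂ}
    (h : Basic B V f) : (genTop B).IsOpen {x | x ∈ V ∧ f x ≠ 0} :=
  TopologicalSpace.GenerateOpen.basic _ ⟨V, f, h, rfl⟩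

/-- The coarsest space with functions for which every `(V, f) ∈ B` is a function `f` regular on
the open set `V` (if `V` is open in the generated topology): a function is regular at `x` if on
a neighbourhood `W` of `x` it is a quotient `g / h` of sums of products of functions of `B`. -/
@[reducible]
def generated {X : Type*} (B : Set (Set X × (X → ℂ))) : SpaceWithFunctions X where
  zariski := genTop B
  RegularAt f x := ∃ V V' g h W, Basic B V g ∧ Basic B V' h ∧ (genTop B).IsOpen W ∧ x ∈ W ∧
    ∀ y ∈ W, y ∈ V ∧ y ∈ V' ∧ h y ≠ 0 ∧ f y = g y / h y
  const c x := ⟨Set.univ, Set.univ, fun _ => c, fun _ => 1, Set.univ, .const c, .const 1,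
    (genTop B).isOpen_univ, trivial, fun y _ => ⟨trivial, trivial, one_ne_zero, by simp⟩⟩
  add := by
    rintro f f' x ⟨V, V', g, h, W, hg, hh, hW, hxW, H⟩ ⟨T, T', k, l, W', hk, hl, hW', hxW', H'⟩
    refine ⟨_, _, _, _, W ∩ W', (hg.mul hl).add (hk.mul hh), hh.mul hl,
      (genTop B).isOpen_inter _ _ hW hW', ⟨hxW, hxW'⟩, ?_⟩
    rintro y ⟨hy, hy'⟩
    obtain ⟨a1, a2, a3, a4⟩ := H y hy
    obtain ⟨b1, b2, b3, b4⟩ := H' y hy'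
    refine ⟨⟨⟨a1, b2⟩, b1, a2⟩, ⟨a2, b2⟩, mul_ne_zero a3 b3, ?_⟩
    simp only [a4, b4]
    field_simp
  mul := by
    rintro f f' x ⟨V, V', g, h, W, hg, hh, hW, hxW, H⟩ ⟨T, T', k, l, W', hk, hl, hW', hxW', H'⟩
    refine ⟨_, _, _, _, W ∩ W', hg.mul hk, hh.mul hl,
      (genTop B).isOpen_inter _ _ hW hW', ⟨hxW, hxW'⟩, ?_⟩
    rintro y ⟨hy, hy'⟩
    obtain ⟨a1, a2, a3, a4⟩ := H y hy
    obtain ⟨b1, b2, b3, b4⟩ := H' y hy'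
    refine ⟨⟨a1, b1⟩, ⟨a2, b2⟩, mul_ne_zero a3 b3, ?_⟩
    simp only [a4, b4]
    field_simp
  inv := by
    rintro f x ⟨V, V', g, h, W, hg, hh, hW, hxW, H⟩ hfx
    have hgx : g x ≠ 0 := fun h0 => hfx (by rw [(H x hxW).2.2.2, h0, zero_div])
    refine ⟨V', V, h, g, W ∩ {y | y ∈ V ∧ g y ≠ 0}, hh, hg,
      (genTop B).isOpen_inter _ _ hW (genTop_basic hg), ⟨hxW, (H x hxW).1, hgx⟩, ?_⟩
    rintro y ⟨hy, hyV, hgy⟩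
    obtain ⟨a1, a2, a3, a4⟩ := H y hy
    exact ⟨a2, a1, hgy, by simp only [a4, inv_div]⟩
  congr := by
    rintro f f' x ⟨V, V', g, h, W, hg, hh, hW, hxW, H⟩ ⟨T, hT, hxT, hTf⟩
    refine ⟨V, V', g, h, W ∩ T, hg, hh, (genTop B).isOpen_inter _ _ hW hT, ⟨hxW, hxT⟩, ?_⟩
    rintro y ⟨hy, hyT⟩
    rw [← hTf y hyT]
    exact H y hy
  spread := by
    rintro f x ⟨V, V', g, h, W, hg, hh, hW, hxW, H⟩
    exact ⟨W, hW, hxW, fun y hy => ⟨V, V', g, h, W, hg, hh, hW, hy, H⟩⟩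
  ne_zero := by
    rintro f x ⟨V, V', g, h, W, hg, hh, hW, hxW, H⟩ hfx
    have hgx : g x ≠ 0 := fun h0 => hfx (by rw [(H x hxW).2.2.2, h0, zero_div])
    refine ⟨W ∩ {y | y ∈ V ∧ g y ≠ 0},
      (genTop B).isOpen_inter _ _ hW (genTop_basic hg), ⟨hxW, (H x hxW).1, hgx⟩, ?_⟩
    rintro y ⟨hy, hyV, hgy⟩
    obtain ⟨a1, a2, a3, a4⟩ := H y hy
    rw [a4]
    exact div_ne_zero hgy a3

/-- The pullbacks along `p : X → Y` of the regular functions on open subsets of `Y`. -/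
def pullback {X Y : Type*} [SpaceWithFunctions Y] (p : X → Y) : Set (Set X × (X → ℂ)) :=
  {b | ∃ (U : Set Y) (g : Y → ℂ), IsZariskiOpen U ∧ RegularOn g U ∧
    b = (p ⁻¹' U, fun x => g (p x))}

/-- The affine line: regular functions are locally quotients of polynomials. -/
instance affineLine : SpaceWithFunctions ℂ := generated {(Set.univ, fun z => z)}

/-- Subsets carry the induced topology and the functions that are locally restrictions of regular
functions: for a locally closed subset this is its (reduced) structure of a subvariety. -/
instance subspace {X : Type*} [SpaceWithFunctions X] (p : X → Prop) :
    SpaceWithFunctions (Subtype p) :=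
  generated (pullback Subtype.val)

/-- The product in the category of spaces with functions, which for varieties is the product of
varieties: regular functions are locally quotients of sums of `f(x) g(y)`, and the sets where such
a sum does not vanish form a basis of the topology. -/
instance prod {X Y : Type*} [SpaceWithFunctions X] [SpaceWithFunctions Y] :
    SpaceWithFunctions (X × Y) :=
  generated (pullback Prod.fst ∪ pullback Prod.snd)

/-- Products of families, in the same way.  In particular `Fin n → ℂ` is affine `n`-space. -/
instance pi {ι : Type*} {Y : ι → Type*} [∀ i, SpaceWithFunctions (Y i)] :
    SpaceWithFunctions (∀ i, Y i) :=
  generated (⋃ i, pullback (fun y : ∀ i, Y i => y i))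

/-- A space of matrices is an affine space. -/
instance matrix {m n : Type*} : SpaceWithFunctions (Matrix m n ℂ) :=
  inferInstanceAs (SpaceWithFunctions (m → n → ℂ))

/-- The quotient structure along `q : X → Y`: a set is open, respectively a function is regular
on an open set, if its pullback along `q` is. -/
@[reducible]
def quotient {X Y : Type*} [S : SpaceWithFunctions X] (q : X → Y) : SpaceWithFunctions Y where
  zariski := TopologicalSpace.coinduced q S.zariski
  RegularAt f y := ∃ V : Set Y, S.zariski.IsOpen (q ⁻¹' V) ∧ y ∈ V ∧
    ∀ x, q x ∈ V → S.RegularAt (fun z => f (q z)) x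
  const c y := ⟨Set.univ, S.zariski.isOpen_univ, trivial, fun x _ => S.const c x⟩
  add := by
    rintro f g y ⟨V, hV, hy, H⟩ ⟨W, hW, hy', H'⟩
    exact ⟨V ∩ W, S.zariski.isOpen_inter _ _ hV hW, ⟨hy, hy'⟩,
      fun x hx => S.add (H x hx.1) (H' x hx.2)⟩
  mul := by
    rintro f g y ⟨V, hV, hy, H⟩ ⟨W, hW, hy', H'⟩
    exact ⟨V ∩ W, S.zariski.isOpen_inter _ _ hV hW, ⟨hy, hy'⟩,
      fun x hx => S.mul (H x hx.1) (H' x hx.2)⟩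
  inv := by
    rintro f y ⟨V, hV, hy, H⟩ hfy
    refine ⟨V ∩ {z | f z ≠ 0}, ?_, ⟨hy, hfy⟩, fun x hx => S.inv (H x hx.1) hx.2⟩
    refine (@isOpen_iff_forall_mem_open X S.zariski _).2 ?_
    rintro x ⟨hx, hfx⟩
    obtain ⟨T, hT, hxT, HT⟩ := S.ne_zero (H x hx) hfx
    exact ⟨q ⁻¹' V ∩ T, fun z hz => ⟨hz.1, HT z hz.2⟩, S.zariski.isOpen_inter _ _ hV hT, hx, hxT⟩
  congr := by
    rintro f g y ⟨V, hV, hy, H⟩ ⟨W, hW, hy', HW⟩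
    refine ⟨V ∩ W, S.zariski.isOpen_inter _ _ hV hW, ⟨hy, hy'⟩, fun x hx => ?_⟩
    exact S.congr (H x hx.1) ⟨q ⁻¹' W, hW, hx.2, fun z hz => HW _ hz⟩
  spread := by
    rintro f y ⟨V, hV, hy, H⟩
    exact ⟨V, hV, hy, fun z hz => ⟨V, hV, hz, H⟩⟩
  ne_zero := by
    rintro f y ⟨V, hV, hy, H⟩ hfy
    refine ⟨V ∩ {z | f z ≠ 0}, ?_, ⟨hy, hfy⟩, fun z hz => hz.2⟩
    refine (@isOpen_iff_forall_mem_open X S.zariski _).2 ?_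
    rintro x ⟨hx, hfx⟩
    obtain ⟨T, hT, hxT, HT⟩ := S.ne_zero (H x hx) hfx
    exact ⟨q ⁻¹' V ∩ T, fun z hz => ⟨hz.1, HT z hz.2⟩, S.zariski.isOpen_inter _ _ hV hT, hx, hxT⟩

end SpaceWithFunctions

/-! ### Grassmannians -/

/-- The set of `d`-dimensional linear subspaces of `ℂ^ι`. -/
@[ext]
structure Gr (d : ℕ) (ι : Type*) where
  space : Submodule ℂ (ι → ℂ)
  finrank_eq : Module.finrank ℂ space = d

/-- Linearly independent `d`-tuples in `ℂ^ι`. -/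
abbrev Frame (d : ℕ) (ι : Type*) := {b : Fin d → ι → ℂ // LinearIndependent ℂ b}

/-- The span of a frame. -/
def Frame.toGr {d : ℕ} {ι : Type*} (b : Frame d ι) : Gr d ι :=
  ⟨Submodule.span ℂ (Set.range b.1), by simpa using finrank_span_eq_card b.2⟩

/-- The Grassmannian as the quotient of the variety of frames by the general linear group. -/
instance Gr.instSpaceWithFunctions {d : ℕ} {ι : Type*} : SpaceWithFunctions (Gr d ι) :=
  SpaceWithFunctions.quotient (Frame.toGr (d := d) (ι := ι))

/-! ### Graded quiver varieties of a bipartite quiver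

A bipartite quiver is given by the set `I₀` of its sinks, the set `I₁` of its sources, and the set
`Ω β α` of arrows `β → α` for `β : I₁` and `α : I₀`. The set of vertices is `I₀ ⊕ I₁`. -/

/-- A dimension vector `w = (w_i, w'_i)`. -/
structure FrameDim (I : Type*) where
  dim : I → ℕ
  dim' : I → ℕ

namespace QuiverVariety

open Sum

variable {I₀ I₁ : Type*} (Ω : I₁ → I₀ → Type*)

/-- The space `E_w` of representations `(x_i, y_h)` of the decorated quiver; `q.1 α : W'_α → W_α`
for sinks `α`, `q.2.1 β : W_β → W'_β` for sources `β`, and `q.2.2 β α h : W_β → W_α` for arrows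
`h : β → α`. -/
abbrev RepSpace (w : FrameDim (I₀ ⊕ I₁)) :=
  (∀ α : I₀, Matrix (Fin (w.dim (inl α))) (Fin (w.dim' (inl α))) ℂ) ×
  (∀ β : I₁, Matrix (Fin (w.dim' (inr β))) (Fin (w.dim (inr β))) ℂ) ×
  (∀ (β : I₁) (α : I₀), Ω β α → Matrix (Fin (w.dim (inl α))) (Fin (w.dim (inr β))) ℂ)

/-- Coordinates on `W'_α ⊕ ⨁_{h : t(h) = α} W_{s(h)}`, for a sink `α`. -/
abbrev SinkIndex (w : FrameDim (I₀ ⊕ I₁)) (α : I₀) :=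
  Fin (w.dim' (inl α)) ⊕ Σ (β : I₁) (_ : Ω β α), Fin (w.dim (inr β))

/-- Coordinates on `W'_β ⊕ ⨁_{h : s(h) = β} W_{t(h)}`, for a source `β`. -/
abbrev SourceIndex (w : FrameDim (I₀ ⊕ I₁)) (β : I₁) :=
  Fin (w.dim' (inr β)) ⊕ Σ (α : I₀) (_ : Ω β α), Fin (w.dim (inl α))

variable {Ω} {w : FrameDim (I₀ ⊕ I₁)}

/-- The block matrix `A_α = [x_α | y_h | ⋯]`. -/
def sinkMatrix (q : RepSpace Ω w) (α : I₀) : Matrix (Fin (w.dim (inl α))) (SinkIndex Ω w α) ℂ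
  | i, inl j => q.1 α i j
  | i, inr ⟨β, h, j⟩ => q.2.2 β α h i j

/-- The block matrix `A_β`, with `x_β` and the `y_h` stacked vertically. -/
def sourceMatrix (q : RepSpace Ω w) (β : I₁) : Matrix (SourceIndex Ω w β) (Fin (w.dim (inr β))) ℂ
  | inl i, j => q.2.1 β i j
  | inr ⟨α, h, i⟩, j => q.2.2 β α h i j

variable (Ω)

/-- The product of Grassmannians containing `F_{v,w}`. -/
abbrev GrProd (v : I₀ ⊕ I₁ → ℕ) (w : FrameDim (I₀ ⊕ I₁)) :=
  (∀ α : I₀, Gr (v (inl α)) (Fin (w.dim (inl α)))) ×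
  (∀ β : I₁, Gr (v (inr β)) (SourceIndex Ω w β))

/-- The projective variety `F_{v,w}`: tuples of subspaces with
`X_β ⊆ W'_β ⊕ ⨁_{h : s(h) = β} X_{t(h)}` for all sources `β`. -/
def F (v : I₀ ⊕ I₁ → ℕ) (w : FrameDim (I₀ ⊕ I₁)) : Set (GrProd Ω v w) :=
  {X | ∀ β, ∀ ξ ∈ (X.2 β).space, ∀ (α : I₀) (h : Ω β α),
    (fun k => ξ (inr ⟨α, h, k⟩)) ∈ (X.1 α).space}

variable [Fintype I₀] [Fintype I₁] [∀ β α, Fintype (Ω β α)]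

/-- The nonsingular graded quiver variety: pairs of `(x_i, y_h) ∈ E_w` and `(X_i) ∈ F_{v,w}` with
`im A_i ⊆ X_i` for all vertices `i`. -/
def Ftilde (v : I₀ ⊕ I₁ → ℕ) (w : FrameDim (I₀ ⊕ I₁)) : Set (RepSpace Ω w × GrProd Ω v w) :=
  {z | z.2 ∈ F Ω v w ∧
    (∀ α, LinearMap.range (sinkMatrix z.1 α).mulVecLin ≤ (z.2.1 α).space) ∧
    (∀ β, LinearMap.range (sourceMatrix z.1 β).mulVecLin ≤ (z.2.2 β).space)}

variable {Ω} in
/-- The rank of `A_i`. -/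
noncomputable def rankA (q : RepSpace Ω w) : I₀ ⊕ I₁ → ℕ
  | inl α => (sinkMatrix q α).rank
  | inr β => (sourceMatrix q β).rank

/-- The affine graded quiver variety `E_{v,w}`. -/
def E (v : I₀ ⊕ I₁ → ℕ) (w : FrameDim (I₀ ⊕ I₁)) : Set (RepSpace Ω w) :=
  {q | ∀ i, rankA q i ≤ v i}

/-- The stratum `E°_{v,w}`. -/
def Stratum (v : I₀ ⊕ I₁ → ℕ) (w : FrameDim (I₀ ⊕ I₁)) : Set (RepSpace Ω w) :=
  {q | ∀ i, rankA q i = v i}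

variable {Ω} in
/-- The projection `π : (x_i, y_h, X_i) ↦ (x_i, y_h)`. -/
def proj {v : I₀ ⊕ I₁ → ℕ} (z : Ftilde Ω v w) : E Ω v w :=
  ⟨z.1.1, by
    rintro (α | β)
    · exact (Submodule.finrank_mono (z.2.2.1 α)).trans (z.1.2.1 α).finrank_eq.le
    · exact (Submodule.finrank_mono (z.2.2.2 β)).trans (z.1.2.2 β).finrank_eq.le⟩

/-- The `q`-analogue `C_q` of the Cartan matrix: `C_q v = (u_i, u'_i)` with `u_i = v_i` and
`u'_i = v_i - ∑_{h : i - j} v_j`, the sum over all arrows `h` with an endpoint `i`. -/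
def Cq (v : I₀ ⊕ I₁ → ℕ) : I₀ ⊕ I₁ → ℤ × ℤ
  | inl α => (v (inl α), v (inl α) - ∑ β : I₁, ∑ _h : Ω β α, (v (inr β) : ℤ))
  | inr β => (v (inr β), v (inr β) - ∑ α : I₀, ∑ _h : Ω β α, (v (inl α) : ℤ))

end QuiverVariety

/-! The slice is a Schur complement. Split the coordinates of each `W_i` into `v₀ i` distinguished
ones and the rest, and write `A_α` in blocks `M_α, B_α` (upper row), `N_α, D_α` (lower row), and
`A_β` in blocks `M_β, P_β` (upper), `C_β, D_β` (lower). The splitting is chosen so that near `p` the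
matrix `M_α` is surjective and `M_β` is injective (`exists_sliceChart`). The blocks `B_α` are made
of pieces of the `P_β`, and the `C_β` of pieces of the `N_α`, so a representation amounts to its
upper left blocks, the `N_α`, the `P_β` and the lower right blocks `D_h` of the `y_h`.

The spaces `ker M_α` and `coker M_β` have the dimensions prescribed by `w - C_q v₀`. The slice
component `perp` consists of `N_α` on `ker M_α`, of `P_β` modulo `im M_β`, and of `D_h - N_α Z_h
P_β`. Here `Z_h` lifts the projection to the `h`-component along `M_α` and at the same time extends
the inclusion of the `h`-component along `M_β`; it exists since both maps induce the same upper left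
block of `y_h`. Removing the slice component gives `base`, and `glue` puts it back. All formulas are
rational in the entries, with the chosen minors as only denominators.

Surjections `sinkRed` and `sourceRed` from the targets of the `A_i` to their analogues for the slice
have kernels of dimension `v₀ i` contained in `im A_i`, and they map `im A_i` onto the image of the
slice matrix. Hence `rank A_i` is `v₀ i` plus the rank on the slice (`rankA_eq`): the stratum is the
zero fibre of `perp`, and all other rank conditions translate. Since each `X_i` contains `im A_i`,
taking images and preimages under these surjections matches the subspaces on both sides. The
incidence condition for `X_β` survives because on `h`-components the two surjections agree up to the
image of the slice matrix (`sinkRed_mulVec_sub_mem`), which lies in the subspace at `α`.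

The maps on Grassmannians are morphisms because tautological subspaces are locally spanned by
regular vectors (`Gr.exists_regular_span`), and conversely regular spanning vectors define a
morphism (`MorphAt.of_span`). -/

namespace SpaceWithFunctions

/-! ### Germs of morphisms and universal properties of subspaces and products -/

/-- `f` is a morphism in a neighbourhood of `x`, expressed through germs at `x`. -/
structure MorphAt {X Y : Type*} [SX : SpaceWithFunctions X] [SY : SpaceWithFunctions Y]
    (f : X → Y) (x : X) : Prop where
  continuousAt : ∀ V : Set Y, IsZariskiOpen V → f x ∈ V →
    ∃ W : Set X, IsZariskiOpen W ∧ x ∈ W ∧ ∀ y ∈ W, f y ∈ V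
  regular : ∀ g : Y → ℂ, RegularAt g (f x) → RegularAt (fun z => g (f z)) x

section General

variable {X Y Z : Type*} [SpaceWithFunctions X] [SpaceWithFunctions Y] [SpaceWithFunctions Z]

theorem isZariskiOpen_univ : IsZariskiOpen (Set.univ : Set X) :=
  (zariski (X := X)).isOpen_univ

theorem IsZariskiOpen.inter {U V : Set X} (hU : IsZariskiOpen U) (hV : IsZariskiOpen V) :
    IsZariskiOpen (U ∩ V) :=
  (zariski (X := X)).isOpen_inter _ _ hU hV

theorem isZariskiOpen_iff_forall {U : Set X} :
    IsZariskiOpen U ↔ ∀ x ∈ U, ∃ V, IsZariskiOpen V ∧ x ∈ V ∧ ∀ y ∈ V, y ∈ U := by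
  refine (@isOpen_iff_forall_mem_open X zariski U).trans (forall₂_congr fun x _ => ?_)
  exact ⟨fun ⟨V, h1, h2, h3⟩ => ⟨V, h2, h3, h1⟩, fun ⟨V, h1, h2, h3⟩ => ⟨V, h3, h1, h2⟩⟩

theorem isMorphism_of_morphAt {f : X → Y} (h : ∀ x, MorphAt f x) : IsMorphism f where
  continuous V hV := isZariskiOpen_iff_forall.2 fun x hx => (h x).continuousAt V hV hx
  regular g x hg := (h x).regular g hg

theorem MorphAt.comp {g : Y → Z} {f : X → Y} {x : X} (hg : MorphAt g (f x)) (hf : MorphAt f x) :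
    MorphAt (fun y => g (f y)) x where
  continuousAt V hV hx := by
    obtain ⟨W, hW, hxW, H⟩ := hg.continuousAt V hV hx
    obtain ⟨T, hT, hxT, H'⟩ := hf.continuousAt W hW hxW
    exact ⟨T, hT, hxT, fun y hy => H _ (H' y hy)⟩
  regular k hk := hf.regular _ (hg.regular k hk)

theorem MorphAt.congr {f g : X → Y} {x : X} (hf : MorphAt f x) {V : Set X}
    (hV : IsZariskiOpen V) (hx : x ∈ V) (h : ∀ y ∈ V, f y = g y) : MorphAt g x where
  continuousAt U hU hxU := by
    obtain ⟨W, hW, hxW, H⟩ := hf.continuousAt U hU (by rwa [h x hx])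
    exact ⟨W ∩ V, hW.inter hV, ⟨hxW, hx⟩, fun y hy => h y hy.2 ▸ H y hy.1⟩
  regular k hk := by
    rw [← h x hx] at hk
    exact SpaceWithFunctions.congr (hf.regular k hk) ⟨V, hV, hx, fun y hy => by rw [h y hy]⟩

/-- Universal property of the coarsest structure: sums and products of generators pull back to
regular functions, hence their nonvanishing loci to neighbourhoods, hence their quotients to regular
germs. -/
theorem MorphAt.of_generated {T : Type*} {B : Set (Set T × (T → ℂ))} {f : X → T} {x : X}
    (h : ∀ V g, (V, g) ∈ B → f x ∈ V →
      (∃ W : Set X, IsZariskiOpen W ∧ x ∈ W ∧ ∀ y ∈ W, f y ∈ V) ∧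
        RegularAt (fun y => g (f y)) x) :
    @MorphAt X T _ (generated B) f x := by
  have key : ∀ V g, Basic B V g → f x ∈ V →
      (∃ W : Set X, IsZariskiOpen W ∧ x ∈ W ∧ ∀ y ∈ W, f y ∈ V) ∧
        RegularAt (fun y => g (f y)) x := by
    intro V g hb
    induction hb with
    | of hB => exact h _ _ hB
    | const c =>
      exact fun _ => ⟨⟨Set.univ, isZariskiOpen_univ, trivial, fun _ _ => trivial⟩, const c x⟩
    | add _ _ ih ih' =>
      rintro ⟨hx, hx'⟩
      obtain ⟨⟨W, hW, hxW, H⟩, hr⟩ := ih hx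
      obtain ⟨⟨W', hW', hxW', H'⟩, hr'⟩ := ih' hx'
      exact ⟨⟨W ∩ W', hW.inter hW', ⟨hxW, hxW'⟩, fun y hy => ⟨H y hy.1, H' y hy.2⟩⟩,
        SpaceWithFunctions.add hr hr'⟩
    | mul _ _ ih ih' =>
      rintro ⟨hx, hx'⟩
      obtain ⟨⟨W, hW, hxW, H⟩, hr⟩ := ih hx
      obtain ⟨⟨W', hW', hxW', H'⟩, hr'⟩ := ih' hx'
      exact ⟨⟨W ∩ W', hW.inter hW', ⟨hxW, hxW'⟩, fun y hy => ⟨H y hy.1, H' y hy.2⟩⟩,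
        SpaceWithFunctions.mul hr hr'⟩
  have cont : ∀ V : Set T, (genTop B).IsOpen V → f x ∈ V →
      ∃ W : Set X, IsZariskiOpen W ∧ x ∈ W ∧ ∀ y ∈ W, f y ∈ V := by
    intro V hV
    induction (show TopologicalSpace.GenerateOpen _ V from hV) with
    | basic s hs =>
      obtain ⟨V, g, hb, rfl⟩ := hs
      rintro ⟨hxV, hgx⟩
      obtain ⟨⟨W, hW, hxW, H⟩, hr⟩ := key V g hb hxV
      obtain ⟨W', hW', hxW', H'⟩ := SpaceWithFunctions.ne_zero hr hgx
      exact ⟨W ∩ W', IsZariskiOpen.inter hW hW', ⟨hxW, hxW'⟩, fun y hy => ⟨H y hy.1, H' y hy.2⟩⟩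
    | univ => exact fun _ => ⟨Set.univ, isZariskiOpen_univ, trivial, fun _ _ => trivial⟩
    | inter s t hs ht ih ih' =>
      rintro ⟨hx, hx'⟩
      obtain ⟨W, hW, hxW, H⟩ := ih hs hx
      obtain ⟨W', hW', hxW', H'⟩ := ih' ht hx'
      exact ⟨W ∩ W', hW.inter hW', ⟨hxW, hxW'⟩, fun y hy => ⟨H y hy.1, H' y hy.2⟩⟩
    | sUnion S hS ih =>
      rintro ⟨s, hs, hx⟩
      obtain ⟨W, hW, hxW, H⟩ := ih s hs (hS s hs) hx
      exact ⟨W, hW, hxW, fun y hy => ⟨s, hs, H y hy⟩⟩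
  refine @MorphAt.mk X T _ (generated B) f x cont ?_
  rintro g ⟨V, V', k, l, W, hk, hl, hW, hxW, H⟩
  obtain ⟨W₀, hW₀, hxW₀, HW₀⟩ := cont W hW hxW
  have h1 := (key V k hk (H _ hxW).1).2
  have h2 := (key V' l hl (H _ hxW).2.1).2
  refine SpaceWithFunctions.congr
    (SpaceWithFunctions.mul h1 (SpaceWithFunctions.inv h2 (H _ hxW).2.2.1))
    ⟨W₀, hW₀, hxW₀, fun y hy => ?_⟩
  rw [(H _ (HW₀ y hy)).2.2.2, div_eq_mul_inv]

theorem MorphAt.of_mem_pullback {T : Type*} {B : Set (Set T × (T → ℂ))} {p : T → Y}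
    (hB : pullback p ⊆ B) (t : T) : @MorphAt T Y (generated B) _ p t := by
  have hopen : ∀ V : Set Y, IsZariskiOpen V → (genTop B).IsOpen (p ⁻¹' V) := by
    intro V hV
    -- The constant `1` on `V` pulls back to a generator whose nonvanishing locus is all of `p ⁻¹'
    -- V`.
    have := genTop_basic (B := B) (V := p ⁻¹' V) (f := fun _ => 1)
      (.of (hB ⟨V, fun _ => 1, hV, fun x _ => const 1 x, rfl⟩))
    simp only [ne_eq, one_ne_zero, not_false_eq_true, and_true] at this
    exact this
  refine @MorphAt.mk T Y (generated B) _ p t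
    (fun V hV hx => ⟨p ⁻¹' V, hopen V hV, hx, fun _ h => h⟩) ?_
  intro g hg
  obtain ⟨V, hV, hx, H⟩ := SpaceWithFunctions.spread hg
  exact ⟨p ⁻¹' V, Set.univ, fun s => g (p s), fun _ => 1, p ⁻¹' V, .of (hB ⟨V, g, hV, H, rfl⟩),
    .const 1, hopen V hV, hx, fun y hy => ⟨hy, trivial, one_ne_zero, by simp⟩⟩

theorem MorphAt.val {p : X → Prop} (x : Subtype p) : MorphAt (fun y : Subtype p => y.1) x :=
  MorphAt.of_mem_pullback subset_rfl x

theorem MorphAt.of_val {p : Y → Prop} {f : X → Subtype p} {x : X}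
    (h : MorphAt (fun y => (f y).1) x) : MorphAt f x := by
  refine MorphAt.of_generated ?_
  rintro _ _ ⟨U, g, hU, hg, h'⟩ hx
  obtain ⟨rfl, rfl⟩ := Prod.mk.inj h'
  exact ⟨h.continuousAt U hU hx, h.regular g (hg _ hx)⟩

theorem MorphAt.fst (x : X × Y) : MorphAt (fun y : X × Y => y.1) x :=
  MorphAt.of_mem_pullback Set.subset_union_left x

theorem MorphAt.snd (x : X × Y) : MorphAt (fun y : X × Y => y.2) x :=
  MorphAt.of_mem_pullback Set.subset_union_right x

theorem MorphAt.fst_comp {f : Z → X × Y} {z : Z} (h : MorphAt f z) :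
    MorphAt (fun y => (f y).1) z :=
  (MorphAt.fst _).comp h

theorem MorphAt.snd_comp {f : Z → X × Y} {z : Z} (h : MorphAt f z) :
    MorphAt (fun y => (f y).2) z :=
  (MorphAt.snd _).comp h

theorem MorphAt.prodMk {f : Z → X × Y} {z : Z} (h₁ : MorphAt (fun y => (f y).1) z)
    (h₂ : MorphAt (fun y => (f y).2) z) : MorphAt f z := by
  refine MorphAt.of_generated ?_
  rintro _ _ (⟨U, g, hU, hg, h'⟩ | ⟨U, g, hU, hg, h'⟩) hx <;> obtain ⟨rfl, rfl⟩ := Prod.mk.inj h'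
  · exact ⟨h₁.continuousAt U hU hx, h₁.regular g (hg _ hx)⟩
  · exact ⟨h₂.continuousAt U hU hx, h₂.regular g (hg _ hx)⟩

theorem MorphAt.apply {ι : Type*} {T : ι → Type*} [∀ i, SpaceWithFunctions (T i)] (i : ι)
    (t : ∀ i, T i) : MorphAt (fun s : ∀ i, T i => s i) t :=
  MorphAt.of_mem_pullback (Set.subset_iUnion (fun i => pullback fun y : ∀ i, T i => y i) i) t

theorem MorphAt.piMk {ι : Type*} {T : ι → Type*} [∀ i, SpaceWithFunctions (T i)]
    {f : Z → ∀ i, T i} {z : Z} (h : ∀ i, MorphAt (fun y => f y i) z) : MorphAt f z := by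
  refine MorphAt.of_generated ?_
  rintro _ _ hB hx
  obtain ⟨i, U, g, hU, hg, h'⟩ := Set.mem_iUnion.1 hB
  obtain ⟨rfl, rfl⟩ := Prod.mk.inj h'
  exact ⟨(h i).continuousAt U hU hx, (h i).regular g (hg _ hx)⟩

theorem regularAt_id (c : ℂ) : RegularAt (fun z : ℂ => z) c :=
  ⟨Set.univ, Set.univ, fun z => z, fun _ => 1, Set.univ, .of rfl,
    .const 1, (genTop _).isOpen_univ, trivial,
    fun y _ => ⟨trivial, trivial, one_ne_zero, by simp⟩⟩

theorem morphAt_iff_regularAt {f : Z → ℂ} {z : Z} : MorphAt f z ↔ RegularAt f z := by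
  refine ⟨fun h => h.regular _ (regularAt_id _), fun h => MorphAt.of_generated ?_⟩
  rintro V g hB hx
  obtain ⟨rfl, rfl⟩ := Prod.mk.inj (Set.mem_singleton_iff.1 hB)
  exact ⟨⟨Set.univ, isZariskiOpen_univ, trivial, fun _ _ => trivial⟩, h⟩

end General

/-! ### Regular families of matrices -/

section Regular

variable {Z : Type*} [SpaceWithFunctions Z] {z : Z}

theorem RegularAt.neg {f : Z → ℂ} (hf : RegularAt f z) : RegularAt (fun y => -f y) z := by
  simpa using SpaceWithFunctions.mul (const (-1) z) hf

theorem RegularAt.sum {κ : Type*} (s : Finset κ) {f : κ → Z → ℂ}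
    (hf : ∀ i ∈ s, RegularAt (f i) z) : RegularAt (fun y => ∑ i ∈ s, f i y) z := by
  classical
  induction s using Finset.induction_on with
  | empty => simpa using const 0 z
  | insert a s ha ih =>
    simp only [Finset.sum_insert ha]
    exact SpaceWithFunctions.add (hf a (by simp)) (ih fun i hi => hf i (by simp [hi]))

theorem RegularAt.prod {κ : Type*} (s : Finset κ) {f : κ → Z → ℂ}
    (hf : ∀ i ∈ s, RegularAt (f i) z) : RegularAt (fun y => ∏ i ∈ s, f i y) z := by
  classical
  induction s using Finset.induction_on with
  | empty => simpa using const 1 z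
  | insert a s ha ih =>
    simp only [Finset.prod_insert ha]
    exact SpaceWithFunctions.mul (hf a (by simp)) (ih fun i hi => hf i (by simp [hi]))

/-- The entries of a matrix valued function are regular at `z`. -/
def RegularMatrixAt {m n : Type*} (A : Z → Matrix m n ℂ) (z : Z) : Prop :=
  ∀ i j, RegularAt (fun y => A y i j) z

namespace RegularMatrixAt

variable {l m n o : Type*}

theorem const (A : Matrix m n ℂ) : RegularMatrixAt (fun _ : Z => A) z :=
  fun i j => SpaceWithFunctions.const (A i j) z

theorem add {A B : Z → Matrix m n ℂ} (hA : RegularMatrixAt A z) (hB : RegularMatrixAt B z) :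
    RegularMatrixAt (fun y => A y + B y) z :=
  fun i j => SpaceWithFunctions.add (hA i j) (hB i j)

theorem neg {A : Z → Matrix m n ℂ} (hA : RegularMatrixAt A z) :
    RegularMatrixAt (fun y => -A y) z :=
  fun i j => (hA i j).neg

theorem sub {A B : Z → Matrix m n ℂ} (hA : RegularMatrixAt A z) (hB : RegularMatrixAt B z) :
    RegularMatrixAt (fun y => A y - B y) z := by
  simpa only [sub_eq_add_neg] using hA.add hB.neg

theorem mul [Fintype m] {A : Z → Matrix l m ℂ} {B : Z → Matrix m n ℂ}
    (hA : RegularMatrixAt A z) (hB : RegularMatrixAt B z) :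
    RegularMatrixAt (fun y => A y * B y) z := by
  intro i j
  simp only [Matrix.mul_apply]
  exact RegularAt.sum _ fun k _ => SpaceWithFunctions.mul (hA i k) (hB k j)

theorem transpose {A : Z → Matrix m n ℂ} (hA : RegularMatrixAt A z) :
    RegularMatrixAt (fun y => (A y).transpose) z :=
  fun i j => hA j i

theorem submatrix {A : Z → Matrix m n ℂ} (hA : RegularMatrixAt A z) (r : l → m) (c : o → n) :
    RegularMatrixAt (fun y => (A y).submatrix r c) z :=
  fun i j => hA (r i) (c j)

theorem fromRows {A : Z → Matrix l n ℂ} {B : Z → Matrix m n ℂ}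
    (hA : RegularMatrixAt A z) (hB : RegularMatrixAt B z) :
    RegularMatrixAt (fun y => Matrix.fromRows (A y) (B y)) z
  | .inl i, j => hA i j
  | .inr i, j => hB i j

theorem fromCols {A : Z → Matrix m l ℂ} {B : Z → Matrix m n ℂ}
    (hA : RegularMatrixAt A z) (hB : RegularMatrixAt B z) :
    RegularMatrixAt (fun y => Matrix.fromCols (A y) (B y)) z
  | i, .inl j => hA i j
  | i, .inr j => hB i j

theorem fromBlocks {A : Z → Matrix n l ℂ} {B : Z → Matrix n m ℂ} {C : Z → Matrix o l ℂ}
    {D : Z → Matrix o m ℂ} (hA : RegularMatrixAt A z) (hB : RegularMatrixAt B z)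
    (hC : RegularMatrixAt C z) (hD : RegularMatrixAt D z) :
    RegularMatrixAt (fun y => Matrix.fromBlocks (A y) (B y) (C y) (D y)) z
  | .inl i, .inl j => hA i j
  | .inl i, .inr j => hB i j
  | .inr i, .inl j => hC i j
  | .inr i, .inr j => hD i j

theorem det [Fintype n] [DecidableEq n] {A : Z → Matrix n n ℂ} (hA : RegularMatrixAt A z) :
    RegularAt (fun y => (A y).det) z := by
  simp only [Matrix.det_apply']
  exact RegularAt.sum _ fun σ _ => SpaceWithFunctions.mul (SpaceWithFunctions.const _ z)
    (RegularAt.prod _ fun i _ => hA _ _)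

/-- Cramer's rule: the entries are the inverse of the determinant times determinants of matrices
with one row replaced by a constant row. -/
theorem inv [Fintype n] [DecidableEq n] {A : Z → Matrix n n ℂ} (hA : RegularMatrixAt A z)
    (hdet : (A z).det ≠ 0) : RegularMatrixAt (fun y => (A y)⁻¹) z := by
  intro i j
  simp only [Matrix.inv_def, Matrix.smul_apply, Ring.inverse_eq_inv', smul_eq_mul,
    Matrix.adjugate_apply]
  refine SpaceWithFunctions.mul (SpaceWithFunctions.inv hA.det hdet) (RegularMatrixAt.det ?_)
  intro a b
  by_cases h : a = j
  · subst h
    simpa using SpaceWithFunctions.const _ z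
  · simpa [Matrix.updateRow_ne h] using hA a b

theorem morphAt {A : Z → Matrix m n ℂ} (hA : RegularMatrixAt A z) : MorphAt A z :=
  MorphAt.piMk (T := fun _ : m => n → ℂ) fun i => MorphAt.piMk fun j =>
    morphAt_iff_regularAt.2 (hA i j)

theorem of_morphAt {A : Z → Matrix m n ℂ} (hA : MorphAt A z) : RegularMatrixAt A z :=
  fun i j => morphAt_iff_regularAt.1
    (((MorphAt.apply (T := fun _ : n => ℂ) j _).comp
      (MorphAt.apply (T := fun _ : m => n → ℂ) i _)).comp (f := A) hA)

theorem eventually_det_ne_zero [Fintype n] [DecidableEq n] {A : Z → Matrix n n ℂ}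
    (hA : RegularMatrixAt A z) (hdet : (A z).det ≠ 0) :
    ∃ V : Set Z, IsZariskiOpen V ∧ z ∈ V ∧ ∀ y ∈ V, (A y).det ≠ 0 :=
  SpaceWithFunctions.ne_zero hA.det hdet

end RegularMatrixAt

end Regular

end SpaceWithFunctions

/-! ### Linear algebra: minors, split exact sequences, kernels and sections given by a minor -/

section LinearAlgebra

open Matrix

/-- A family whose span has dimension `d` has a linearly independent subfamily of `d` vectors. -/
theorem exists_linearIndependent_comp {V κ : Type*} [AddCommGroup V] [Module ℂ V]
    [FiniteDimensional ℂ V] (g : κ → V) {d : ℕ}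
    (hd : Module.finrank ℂ (Submodule.span ℂ (Set.range g)) = d) :
    ∃ c : Fin d → κ, LinearIndependent ℂ (g ∘ c) := by
  subst hd
  obtain ⟨f, hf, -, hli⟩ := Submodule.exists_fun_fin_finrank_span_eq ℂ (Set.range g)
  choose c hc using hf
  exact ⟨c, by rwa [show g ∘ c = f from funext hc]⟩

/-- Linearly independent rows have a nonvanishing maximal minor. -/
theorem exists_det_submatrix_ne_zero {n : Type*} [Fintype n] {d : ℕ} (A : Matrix (Fin d) n ℂ)
    (hA : LinearIndependent ℂ A.row) : ∃ c : Fin d → n, (A.submatrix id c).det ≠ 0 := by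
  have h1 : Aᵀ.rank = d := by
    rw [rank_transpose, LinearIndependent.rank_matrix hA, Fintype.card_fin]
  rw [rank_eq_finrank_span_row] at h1
  obtain ⟨c, hc⟩ := exists_linearIndependent_comp Aᵀ.row h1
  refine ⟨c, ?_⟩
  have h3 : LinearIndependent ℂ ((A.submatrix id c)ᵀ).row := hc
  rw [linearIndependent_rows_iff_isUnit] at h3
  have h4 := (isUnit_iff_isUnit_det _).1 h3
  rw [det_transpose] at h4
  exact h4.ne_zero

/-- A matrix of rank `d` has a nonvanishing minor of size `d`. -/
theorem exists_det_submatrix_ne_zero_of_finrank {κ n : Type*} [Fintype n] {d : ℕ}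
    (A : Matrix κ n ℂ) (hA : Module.finrank ℂ (Submodule.span ℂ (Set.range A.row)) = d) :
    ∃ (r : Fin d → κ) (c : Fin d → n), (A.submatrix r c).det ≠ 0 := by
  obtain ⟨r, hr⟩ := exists_linearIndependent_comp A.row hA
  obtain ⟨c, hc⟩ := exists_det_submatrix_ne_zero (A.submatrix r id) hr
  exact ⟨r, c, hc⟩

theorem linearIndependent_of_det_submatrix_ne_zero {κ n : Type*} {d : ℕ} {A : Matrix κ n ℂ}
    {r : Fin d → κ} {c : Fin d → n} (h : (A.submatrix r c).det ≠ 0) :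
    LinearIndependent ℂ (fun i => A.row (r i)) :=
  LinearIndependent.of_comp (LinearMap.funLeft ℂ ℂ c) (linearIndependent_rows_of_det_ne_zero h)

/-- An injective map from a `Fin a` extends to a bijection of `Fin a ⊕ Fin b` with the target. -/
theorem exists_sum_equiv_of_injective {a b : ℕ} {n : Type*} [Fintype n] (c : Fin a → n)
    (hc : Function.Injective c) (hcard : Fintype.card n = a + b) :
    ∃ e : Fin a ⊕ Fin b ≃ n, ∀ i, e (.inl i) = c i := by
  classical
  have h : Fintype.card (Fin b) = Fintype.card {x : n // x ∉ Set.range c} := by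
    rw [Fintype.card_subtype_compl, Fintype.card_fin, hcard,
      ← Fintype.card_congr (Equiv.ofInjective c hc), Fintype.card_fin]
    omega
  exact ⟨((Equiv.ofInjective c hc).sumCongr (Fintype.equivOfCardEq h)).trans
    (Equiv.Set.sumCompl (Set.range c)), fun i => rfl⟩

theorem injective_of_det_submatrix_ne_zero {d : ℕ} {m n : Type*} {A : Matrix m n ℂ}
    {r : Fin d → m} {c : Fin d → n} (h : (A.submatrix r c).det ≠ 0) :
    Function.Injective r ∧ Function.Injective c := by
  constructor
  · intro i j hij
    by_contra hne
    exact h (det_zero_of_row_eq hne (by ext k; simp [hij]))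
  · intro i j hij
    by_contra hne
    exact h (det_zero_of_column_eq hne (by intro k; simp [hij]))

/-- Two families with the same span of maximal dimension differ by an invertible matrix. -/
theorem exists_mul_eq_of_span_eq {d : ℕ} {ι : Type*} {a b : Matrix (Fin d) ι ℂ}
    (ha : LinearIndependent ℂ a)
    (h : Submodule.span ℂ (Set.range a) = Submodule.span ℂ (Set.range b)) :
    ∃ T : Matrix (Fin d) (Fin d) ℂ, IsUnit T.det ∧ a = T * b := by
  have key : ∀ {a b : Matrix (Fin d) ι ℂ},
      Submodule.span ℂ (Set.range a) = Submodule.span ℂ (Set.range b) →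
      ∃ T : Matrix (Fin d) (Fin d) ℂ, a = T * b := by
    intro a b h
    have : ∀ i, ∃ t : Fin d → ℂ, ∑ j, t j • b j = a i := fun i =>
      (Submodule.mem_span_range_iff_exists_fun ℂ).1 (h ▸ Submodule.subset_span ⟨i, rfl⟩)
    choose T hT using this
    refine ⟨Matrix.of T, Matrix.ext fun i k => ?_⟩
    have := congrFun (hT i) k
    simpa [mul_apply] using this.symm
  obtain ⟨T, hT⟩ := key h
  obtain ⟨S, hS⟩ := key h.symm
  refine ⟨T, ?_, hT⟩
  -- `T * S` fixes the linearly independent family `a`, so it is the identity.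
  have h1 : (T * S - 1) * a = 0 := by
    rw [Matrix.sub_mul, Matrix.mul_assoc, ← hS, ← hT, Matrix.one_mul, sub_self]
  have h2 : T * S - 1 = 0 := by
    ext i j
    have := Fintype.linearIndependent_iff.1 ha (fun j => (T * S - 1) i j) (by
      ext k
      have := congrFun (congrFun h1 i) k
      rw [mul_apply] at this
      simpa using this) j
    simpa using this
  exact isUnit_det_of_right_inverse (sub_eq_zero.1 h2)

/-- A split exact sequence `0 → ℂ^a → ℂ^m → ℂ^n → 0`. -/
structure SplitExact {a m n : Type*} [Fintype a] [Fintype m] [Fintype n] [DecidableEq a]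
    [DecidableEq m] [DecidableEq n] (G : Matrix m a ℂ) (R : Matrix n m ℂ) (σ : Matrix m n ℂ)
    (τ : Matrix a m ℂ) : Prop where
  R_mul_G : R * G = 0
  R_mul_σ : R * σ = 1
  τ_mul_G : τ * G = 1
  add_eq : G * τ + σ * R = 1

namespace SplitExact

variable {a m n : Type*} [Fintype a] [Fintype m] [Fintype n] [DecidableEq a]
    [DecidableEq m] [DecidableEq n] {G : Matrix m a ℂ} {R : Matrix n m ℂ} {σ : Matrix m n ℂ}
    {τ : Matrix a m ℂ}

theorem ker_eq (h : SplitExact G R σ τ) :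
    LinearMap.ker R.mulVecLin = LinearMap.range G.mulVecLin := by
  ext x
  simp only [LinearMap.mem_ker, mulVecLin_apply, LinearMap.mem_range]
  constructor
  · intro hx
    refine ⟨τ *ᵥ x, ?_⟩
    have := congrArg (· *ᵥ x) h.add_eq
    simpa [add_mulVec, ← mulVec_mulVec, hx] using this
  · rintro ⟨y, rfl⟩
    rw [mulVec_mulVec, h.R_mul_G, zero_mulVec]

theorem surjective (h : SplitExact G R σ τ) : Function.Surjective R.mulVecLin := fun y =>
  ⟨σ *ᵥ y, by simp [h.R_mul_σ]⟩

theorem finrank_range (h : SplitExact G R σ τ) :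
    Module.finrank ℂ (LinearMap.range G.mulVecLin) = Fintype.card a := by
  rw [LinearMap.finrank_range_of_inj, Module.finrank_fintype_fun_eq_card]
  intro x y hxy
  have := congrArg (τ *ᵥ ·) hxy
  simpa [h.τ_mul_G] using this

theorem comap_map (h : SplitExact G R σ τ) {X : Submodule ℂ (m → ℂ)}
    (hX : LinearMap.range G.mulVecLin ≤ X) : (X.map R.mulVecLin).comap R.mulVecLin = X := by
  rw [Submodule.comap_map_eq, h.ker_eq, sup_eq_left.2 hX]

theorem map_comap (h : SplitExact G R σ τ) (Y : Submodule ℂ (n → ℂ)) :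
    (Y.comap R.mulVecLin).map R.mulVecLin = Y :=
  Submodule.map_comap_eq_of_surjective h.surjective Y

theorem range_le_comap (h : SplitExact G R σ τ) (Y : Submodule ℂ (n → ℂ)) :
    LinearMap.range G.mulVecLin ≤ Y.comap R.mulVecLin := by
  rw [← h.ker_eq]
  exact LinearMap.ker_le_comap _

/-- Rank-nullity for `R` restricted to `X`, whose kernel is the whole of `ker R`. This count yields
both the rank formula and the dimensions of the subspaces in the slice. -/
theorem finrank_map (h : SplitExact G R σ τ) {X : Submodule ℂ (m → ℂ)}
    (hX : LinearMap.range G.mulVecLin ≤ X) :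
    Fintype.card a + Module.finrank ℂ (X.map R.mulVecLin) = Module.finrank ℂ X := by
  have h1 := LinearMap.finrank_range_add_finrank_ker (R.mulVecLin.domRestrict X)
  rw [LinearMap.range_domRestrict, LinearMap.ker_domRestrict, h.ker_eq,
    (Submodule.comapSubtypeEquivOfLe hX).finrank_eq, h.finrank_range] at h1
  omega

theorem finrank_comap (h : SplitExact G R σ τ) (Y : Submodule ℂ (n → ℂ)) :
    Module.finrank ℂ (Y.comap R.mulVecLin) = Fintype.card a + Module.finrank ℂ Y := by
  rw [← h.finrank_map (h.range_le_comap Y), h.map_comap]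

/-- A preimage is the kernel, spanned by the columns of `G`, plus lifts of spanning vectors along
`σ`. These explicit generators show that preimages vary regularly. -/
theorem comap_span (h : SplitExact G R σ τ) {κ : Type*} (b : κ → n → ℂ) :
    (Submodule.span ℂ (Set.range b)).comap R.mulVecLin =
      Submodule.span ℂ (Set.range (Sum.elim (fun i => Gᵀ i) (fun i => σ *ᵥ b i))) := by
  have hR : ∀ i, R *ᵥ Gᵀ i = 0 := fun i => by
    have : Gᵀ i = G *ᵥ Pi.single i 1 := by simp [col]
    rw [this, mulVec_mulVec, h.R_mul_G, zero_mulVec]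
  have hG : LinearMap.range G.mulVecLin = Submodule.span ℂ (Set.range fun i => Gᵀ i) :=
    range_mulVecLin G
  rw [Set.Sum.elim_range, Submodule.span_union, ← hG]
  have h1 : (Submodule.span ℂ (Set.range fun i => σ *ᵥ b i)).map R.mulVecLin =
      Submodule.span ℂ (Set.range b) := by
    rw [Submodule.map_span, ← Set.range_comp]
    congr 2
    ext i : 1
    simp [h.R_mul_σ]
  rw [← h1, Submodule.comap_map_eq, h.ker_eq, sup_comm]

end SplitExact

section Minor

variable {a b : ℕ} {J : Type*} (e : Fin a ⊕ Fin b ≃ J) (M : Matrix (Fin a) J ℂ)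

/-- The maximal minor of `M` on the columns `e ∘ inl`. -/
def minor : Matrix (Fin a) (Fin a) ℂ := M.submatrix id (e ∘ Sum.inl)

/-- The right inverse of `M` with image in the coordinate subspace of the columns `e ∘ inl`. -/
noncomputable def minorSection : Matrix J (Fin a) ℂ :=
  (fromRows (minor e M)⁻¹ (0 : Matrix (Fin b) (Fin a) ℂ)).submatrix e.symm id

/-- The basis of the kernel of `M` that is dual to the coordinates `e ∘ inr`. -/
noncomputable def minorKernel : Matrix J (Fin b) ℂ :=
  (fromRows (-((minor e M)⁻¹ * M.submatrix id (e ∘ Sum.inr)))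
    (1 : Matrix (Fin b) (Fin b) ℂ)).submatrix e.symm id

/-- The projection to the coordinates `e ∘ inr`. -/
def minorCoord : Matrix (Fin b) J ℂ :=
  (fromCols (0 : Matrix (Fin b) (Fin a) ℂ) (1 : Matrix (Fin b) (Fin b) ℂ)).submatrix id e.symm

theorem eq_submatrix_fromCols :
    M = (fromCols (minor e M) (M.submatrix id (e ∘ Sum.inr))).submatrix id e.symm := by
  ext i j
  obtain ⟨k | k, rfl⟩ := e.surjective j <;> simp [minor]

theorem submatrix_symm_mul_submatrix_symm {l n x : Type*} [Fintype J] [Fintype x] (A : Matrix l x ℂ)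
    (B : Matrix x n ℂ) (ε : x ≃ J) :
    A.submatrix id ε.symm * B.submatrix ε.symm id = A * B := by
  rw [submatrix_mul_equiv]; simp

variable {e M}

theorem mul_minorSection [Fintype J] (h : (minor e M).det ≠ 0) : M * minorSection e M = 1 := by
  nth_rewrite 1 [eq_submatrix_fromCols e M]
  rw [minorSection, submatrix_symm_mul_submatrix_symm, fromCols_mul_fromRows,
    mul_nonsing_inv _ h.isUnit, Matrix.mul_zero, add_zero]

theorem mul_minorKernel [Fintype J] (h : (minor e M).det ≠ 0) : M * minorKernel e M = 0 := by
  nth_rewrite 1 [eq_submatrix_fromCols e M]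
  rw [minorKernel, submatrix_symm_mul_submatrix_symm, fromCols_mul_fromRows, Matrix.mul_neg,
    ← Matrix.mul_assoc, mul_nonsing_inv _ h.isUnit, Matrix.one_mul, Matrix.mul_one,
    neg_add_cancel]

theorem minorCoord_mul_minorKernel [Fintype J] : minorCoord e * minorKernel e M = 1 := by
  rw [minorKernel, minorCoord, submatrix_symm_mul_submatrix_symm, fromCols_mul_fromRows]
  simp

/-- In the coordinates given by `e`, the first product has upper row `1, m⁻¹M'` and the second has
rows `0, -m⁻¹M'` and `0, 1`, where `m` is the minor and `M'` the remaining columns; the off-diagonal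
blocks cancel. -/
theorem minorSection_mul_add [DecidableEq J] (h : (minor e M).det ≠ 0) :
    minorSection e M * M + minorKernel e M * minorCoord e = 1 := by
  have h1 : minorSection e M * M = (fromBlocks 1 ((minor e M)⁻¹ * M.submatrix id (e ∘ Sum.inr))
      0 0).submatrix e.symm e.symm := by
    nth_rewrite 2 [eq_submatrix_fromCols e M]
    rw [minorSection, ← submatrix_mul _ _ _ _ _ Function.bijective_id, fromRows_mul_fromCols,
      nonsing_inv_mul _ h.isUnit, Matrix.zero_mul, Matrix.zero_mul]
  have h2 : minorKernel e M * minorCoord e =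
      (fromBlocks 0 (-((minor e M)⁻¹ * M.submatrix id (e ∘ Sum.inr))) 0 1).submatrix
        e.symm e.symm := by
    rw [minorKernel, minorCoord, ← submatrix_mul _ _ _ _ _ Function.bijective_id,
      fromRows_mul_fromCols]
    simp
  rw [h1, h2]
  refine (congrFun (congrFun (submatrix_add _ _) e.symm) e.symm).symm.trans ?_
  rw [fromBlocks_add]
  simp [fromBlocks_one]

end Minor

end LinearAlgebra

namespace SpaceWithFunctions

/-! ### Grassmannians: regular spanning vectors and morphisms -/

section Grassmannian

variable {d : ℕ} {ι : Type*}

theorem MorphAt.toGr (b : Frame d ι) : MorphAt (Frame.toGr (d := d) (ι := ι)) b :=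
  ⟨fun V hV hx => ⟨Frame.toGr ⁻¹' V, hV, hx, fun _ h => h⟩, fun _ ⟨_, _, hb, H⟩ => H b hb⟩

theorem RegularMatrixAt.frame (b : Frame d ι) :
    RegularMatrixAt (fun b : Frame d ι => Matrix.of b.1) b :=
  RegularMatrixAt.of_morphAt (m := Fin d) (n := ι) (MorphAt.val b)

variable [Fintype ι]

theorem Gr.exists_frame (X : Gr d ι) : ∃ b : Frame d ι, b.toGr = X := by
  have b := Module.finBasisOfFinrankEq ℂ X.space X.finrank_eq
  refine ⟨⟨fun i => (b i : ι → ℂ), b.linearIndependent.map' X.space.subtype (by simp)⟩, ?_⟩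
  ext1
  change Submodule.span ℂ (Set.range (X.space.subtype ∘ b)) = X.space
  rw [Set.range_comp, ← Submodule.map_span, b.span_eq, Submodule.map_subtype_top]

/-- The tautological subspaces of a Grassmannian are locally spanned by regular vectors. -/
theorem Gr.exists_regular_span (X : Gr d ι) :
    ∃ g : Gr d ι → Matrix (Fin d) ι ℂ, RegularMatrixAt g X ∧
      ∃ V : Set (Gr d ι), IsZariskiOpen V ∧ X ∈ V ∧
        ∀ Y ∈ V, Submodule.span ℂ (Set.range (g Y).row) = Y.space := by
  choose B hB using Gr.exists_frame (d := d) (ι := ι)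
  obtain ⟨c, hc⟩ := exists_det_submatrix_ne_zero (Matrix.of (B X).1) (B X).2
  have key : ∀ b : Frame d ι, ∃ T : Matrix (Fin d) (Fin d) ℂ, IsUnit T.det ∧
      Matrix.of (B b.toGr).1 = T * Matrix.of b.1 := fun b =>
    exists_mul_eq_of_span_eq (B b.toGr).2 (congrArg Gr.space (hB b.toGr))
  let m : Frame d ι → Matrix (Fin d) (Fin d) ℂ := fun b => (Matrix.of b.1).submatrix id c
  -- The frames `B` are chosen with no regularity. Two frames of one subspace differ by an
  -- invertible `T`, which cancels in this normalisation, so on the variety of frames `g` is given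
  -- by a formula that does not involve `B`.
  let g : Gr d ι → Matrix (Fin d) ι ℂ := fun Y => (m (B Y))⁻¹ * Matrix.of (B Y).1
  let V : Set (Gr d ι) := {Y | (m (B Y)).det ≠ 0}
  have hm : ∀ (b : Frame d ι) (T : Matrix (Fin d) (Fin d) ℂ),
      Matrix.of (B b.toGr).1 = T * Matrix.of b.1 → m (B b.toGr) = T * m b := by
    intro b T hT
    simp only [m, hT]
    rw [Matrix.submatrix_mul _ _ id id c Function.bijective_id, Matrix.submatrix_id_id]
  have hV : ∀ b : Frame d ι, b.toGr ∈ V ↔ (m b).det ≠ 0 := by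
    intro b
    obtain ⟨T, hT, h⟩ := key b
    simp [V, hm b T h, Matrix.det_mul, hT.ne_zero]
  have hg : ∀ b : Frame d ι, g b.toGr = (m b)⁻¹ * Matrix.of b.1 := by
    intro b
    obtain ⟨T, hT, h⟩ := key b
    simp only [g, hm b T h, Matrix.mul_inv_rev]
    rw [h, Matrix.mul_assoc, ← Matrix.mul_assoc T⁻¹, Matrix.nonsing_inv_mul _ hT, Matrix.one_mul]
  have hmreg : ∀ b, RegularMatrixAt m b := fun b => (RegularMatrixAt.frame b).submatrix id c
  have hVopen : IsZariskiOpen (Frame.toGr ⁻¹' V) := by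
    refine isZariskiOpen_iff_forall.2 fun b hb => ?_
    obtain ⟨W, hW, hbW, H⟩ := (hmreg b).eventually_det_ne_zero ((hV b).1 hb)
    exact ⟨W, hW, hbW, fun y hy => (hV y).2 (H y hy)⟩
  refine ⟨g, fun i j => ⟨V, hVopen, hc, fun b hb => ?_⟩, V, hVopen, hc, fun Y hY => ?_⟩
  · simp only [hg]
    exact ((hmreg b).inv ((hV b).1 hb)).mul (RegularMatrixAt.frame b) i j
  · have h1 : Submodule.span ℂ (Set.range (B Y).1) = Y.space := congrArg Gr.space (hB Y)
    have hu : IsUnit (m (B Y)).det := IsUnit.mk0 _ hY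
    have hle : ∀ {A B : Matrix (Fin d) ι ℂ} {T : Matrix (Fin d) (Fin d) ℂ}, A = T * B →
        Submodule.span ℂ (Set.range A.row) ≤ Submodule.span ℂ (Set.range B.row) := by
      rintro A B T rfl
      rw [Submodule.span_le]
      rintro _ ⟨i, rfl⟩
      refine (Submodule.mem_span_range_iff_exists_fun ℂ).2 ⟨T i, ?_⟩
      ext k
      simp [Matrix.mul_apply]
    rw [← h1]
    refine le_antisymm (hle (A := g Y) (B := Matrix.of (B Y).1) rfl)
      (hle (A := Matrix.of (B Y).1) (B := g Y) (T := m (B Y)) ?_)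
    simp only [g]
    rw [← Matrix.mul_assoc, Matrix.mul_nonsing_inv _ hu, Matrix.one_mul]

/-- A map to a Grassmannian is a morphism if its values are locally spanned by regular vectors. -/
theorem MorphAt.of_span {Z κ : Type*} [SpaceWithFunctions Z] {f : Z → Gr d ι} {z : Z}
    {g : Z → Matrix κ ι ℂ} (hg : RegularMatrixAt g z) {V : Set Z} (hV : IsZariskiOpen V)
    (hz : z ∈ V) (hspan : ∀ y ∈ V, Submodule.span ℂ (Set.range (g y).row) = (f y).space) :
    MorphAt f z := by
  obtain ⟨c, c', hc'⟩ := exists_det_submatrix_ne_zero_of_finrank (g z) (d := d)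
    (by rw [hspan z hz]; exact (f z).finrank_eq)
  obtain ⟨W, hW, hzW, HW⟩ := RegularMatrixAt.eventually_det_ne_zero (A := fun y =>
    (g y).submatrix c c') (hg.submatrix c c') hc'
  have hli : ∀ y ∈ W, LinearIndependent ℂ (fun i => (g y).row (c i)) := fun y hy =>
    linearIndependent_of_det_submatrix_ne_zero (HW y hy)
  classical
  -- Off `W` the frame is set to its value at `z` only to have a total function; the germ at `z`
  -- does not see it.
  let fr : Z → Frame d ι := fun y =>
    if h : LinearIndependent ℂ (fun i => (g y).row (c i)) then ⟨fun i => (g y).row (c i), h⟩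
    else ⟨fun i => (g z).row (c i), hli z hzW⟩
  have hfr : MorphAt fr z := by
    have h1 : MorphAt (fun y i k => g y (c i) k) z :=
      MorphAt.piMk fun i => MorphAt.piMk fun k => morphAt_iff_regularAt.2 (hg (c i) k)
    refine MorphAt.of_val (h1.congr hW hzW fun y hy => ?_)
    simp only [fr, dif_pos (hli y hy)]
    rfl
  refine ((MorphAt.toGr _).comp hfr).congr (hW.inter hV) ⟨hzW, hz⟩ fun y hy => ?_
  simp only [fr, dif_pos (hli y hy.1)]
  ext1
  -- The `d` selected rows are independent in a `d`-dimensional space, so they already span it.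
  refine Submodule.eq_of_le_of_finrank_eq ?_ ?_
  · rw [← hspan y hy.2]
    exact Submodule.span_mono (Set.range_comp_subset_range c (g y).row)
  · rw [Gr.finrank_eq, Gr.finrank_eq]

end Grassmannian

end SpaceWithFunctions

set_option linter.unusedSectionVars false

/-! ### Slice charts: block decomposition, slice component and gluing -/

namespace QuiverVariety

open Sum Matrix

/-- The columns of a matrix product with a coordinate inclusion. -/
theorem mul_one_submatrix {l m n : Type*} [Fintype m] [DecidableEq m] (A : Matrix l m ℂ) (f : n → m) :
    A * (1 : Matrix m m ℂ).submatrix id f = A.submatrix id f := by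
  ext i j
  simp [mul_apply, one_apply]

/-- The rows of a matrix product with a coordinate projection. -/
theorem one_submatrix_mul {l m n : Type*} [Fintype m] [DecidableEq m] (A : Matrix m n ℂ) (f : l → m) :
    (1 : Matrix m m ℂ).submatrix f id * A = A.submatrix f id := by
  ext i j
  simp [mul_apply, one_apply]

variable {I₀ I₁ : Type*} (Ω : I₁ → I₀ → Type*) (v₀ : I₀ ⊕ I₁ → ℕ) (w wP : FrameDim (I₀ ⊕ I₁))

/-- The dimension vector with `w_i` replaced by `v₀_i`. -/
abbrev coreDim : FrameDim (I₀ ⊕ I₁) := ⟨v₀, w.dim'⟩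

variable {Ω} in
/-- The coordinates of the `h`-component of the source of the maps to a sink. -/
abbrev sinkIncl {β : I₁} {α : I₀} (h : Ω β α) (j : Fin (v₀ (inr β))) :
    SinkIndex Ω (coreDim v₀ w) α :=
  inr ⟨β, h, j⟩

variable {Ω} in
/-- The coordinates of the `h`-component of the target of the maps from a source. -/
abbrev sourceIncl {β : I₁} {α : I₀} (h : Ω β α) (i : Fin (v₀ (inl α))) :
    SourceIndex Ω (coreDim v₀ w) β :=
  inr ⟨α, h, i⟩

/-- Splittings of the coordinates on the spaces `W_i` and on the sources, respectively targets, of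
the maps between the first summands. They determine which minors are inverted in the construction
of a transversal slice. -/
structure SliceChart where
  e : ∀ i, Fin (v₀ i) ⊕ Fin (wP.dim i) ≃ Fin (w.dim i)
  fSink : ∀ α : I₀, Fin (v₀ (inl α)) ⊕ Fin (wP.dim' (inl α)) ≃ SinkIndex Ω (coreDim v₀ w) α
  fSource : ∀ β : I₁, Fin (v₀ (inr β)) ⊕ Fin (wP.dim' (inr β)) ≃ SourceIndex Ω (coreDim v₀ w) β

namespace SliceChart

variable {Ω v₀ w wP} (C : SliceChart Ω v₀ w wP)

/-- The induced splitting of the coordinates on the source of `A_α`. -/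
def sinkEquiv (α : I₀) :
    SinkIndex Ω (coreDim v₀ w) α ⊕ (Σ (β : I₁) (_ : Ω β α), Fin (wP.dim (inr β))) ≃
      SinkIndex Ω w α where
  toFun := Sum.elim (Sum.map id fun x => ⟨x.1, x.2.1, C.e (inr x.1) (inl x.2.2)⟩)
    fun x => inr ⟨x.1, x.2.1, C.e (inr x.1) (inr x.2.2)⟩
  invFun := Sum.elim (fun j => inl (inl j)) fun x =>
    Sum.map (fun j => inr ⟨x.1, x.2.1, j⟩) (fun k => ⟨x.1, x.2.1, k⟩) ((C.e (inr x.1)).symm x.2.2)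
  left_inv := by rintro ((j | ⟨β, h, j⟩) | ⟨β, h, k⟩) <;> simp
  right_inv := by
    rintro (j | ⟨β, h, j⟩)
    · simp
    · obtain ⟨k | k, rfl⟩ := (C.e (inr β)).surjective j <;> simp

/-- The induced splitting of the coordinates on the target of `A_β`. -/
def sourceEquiv (β : I₁) :
    SourceIndex Ω (coreDim v₀ w) β ⊕ (Σ (α : I₀) (_ : Ω β α), Fin (wP.dim (inl α))) ≃
      SourceIndex Ω w β where
  toFun := Sum.elim (Sum.map id fun x => ⟨x.1, x.2.1, C.e (inl x.1) (inl x.2.2)⟩)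
    fun x => inr ⟨x.1, x.2.1, C.e (inl x.1) (inr x.2.2)⟩
  invFun := Sum.elim (fun j => inl (inl j)) fun x =>
    Sum.map (fun j => inr ⟨x.1, x.2.1, j⟩) (fun k => ⟨x.1, x.2.1, k⟩) ((C.e (inl x.1)).symm x.2.2)
  left_inv := by rintro ((j | ⟨α, h, j⟩) | ⟨α, h, k⟩) <;> simp
  right_inv := by
    rintro (j | ⟨α, h, j⟩)
    · simp
    · obtain ⟨k | k, rfl⟩ := (C.e (inl α)).surjective j <;> simp

section Blocks

variable (q : RepSpace Ω w)

/-- The upper left block of `A_α`. -/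
def sinkM (α : I₀) : Matrix (Fin (v₀ (inl α))) (SinkIndex Ω (coreDim v₀ w) α) ℂ :=
  (sinkMatrix q α).submatrix (C.e (inl α) ∘ inl) (C.sinkEquiv α ∘ inl)

/-- The lower left block of `A_α`. -/
def sinkN (α : I₀) : Matrix (Fin (wP.dim (inl α))) (SinkIndex Ω (coreDim v₀ w) α) ℂ :=
  (sinkMatrix q α).submatrix (C.e (inl α) ∘ inr) (C.sinkEquiv α ∘ inl)

/-- The upper left block of `A_β`. -/
def sourceM (β : I₁) : Matrix (SourceIndex Ω (coreDim v₀ w) β) (Fin (v₀ (inr β))) ℂ :=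
  (sourceMatrix q β).submatrix (C.sourceEquiv β ∘ inl) (C.e (inr β) ∘ inl)

/-- The upper right block of `A_β`. -/
def sourceP (β : I₁) : Matrix (SourceIndex Ω (coreDim v₀ w) β) (Fin (wP.dim (inr β))) ℂ :=
  (sourceMatrix q β).submatrix (C.sourceEquiv β ∘ inl) (C.e (inr β) ∘ inr)

/-- The lower right block of `y_h`. -/
def arrowD (β : I₁) (α : I₀) (h : Ω β α) :
    Matrix (Fin (wP.dim (inl α))) (Fin (wP.dim (inr β))) ℂ :=
  (q.2.2 β α h).submatrix (C.e (inl α) ∘ inr) (C.e (inr β) ∘ inr)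

/-- The upper right block of `A_α`. -/
def sinkB (α : I₀) :
    Matrix (Fin (v₀ (inl α))) (Σ (β : I₁) (_ : Ω β α), Fin (wP.dim (inr β))) ℂ :=
  Matrix.of fun i x => C.sourceP q x.1 (inr ⟨α, x.2.1, i⟩) x.2.2

/-- The lower right block of `A_α`. -/
def sinkD (α : I₀) :
    Matrix (Fin (wP.dim (inl α))) (Σ (β : I₁) (_ : Ω β α), Fin (wP.dim (inr β))) ℂ :=
  Matrix.of fun i x => C.arrowD q x.1 α x.2.1 i x.2.2

/-- The lower left block of `A_β`. -/
def sourceC (β : I₁) :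
    Matrix (Σ (α : I₀) (_ : Ω β α), Fin (wP.dim (inl α))) (Fin (v₀ (inr β))) ℂ :=
  Matrix.of fun x j => C.sinkN q x.1 x.2.2 (inr ⟨β, x.2.1, j⟩)

/-- The lower right block of `A_β`. -/
def sourceD (β : I₁) :
    Matrix (Σ (α : I₀) (_ : Ω β α), Fin (wP.dim (inl α))) (Fin (wP.dim (inr β))) ℂ :=
  Matrix.of fun x k => C.arrowD q β x.1 x.2.1 x.2.2 k

theorem sinkMatrix_eq (α : I₀) : sinkMatrix q α =
    (fromBlocks (C.sinkM q α) (C.sinkB q α) (C.sinkN q α) (C.sinkD q α)).submatrix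
      (C.e (inl α)).symm (C.sinkEquiv α).symm := by
  ext i j
  obtain ⟨i, rfl⟩ := (C.e (inl α)).surjective i
  obtain ⟨j, rfl⟩ := (C.sinkEquiv α).surjective j
  rcases i with i | i <;> rcases j with j | ⟨β, h, j⟩ <;>
    simp [sinkM, sinkN, sinkB, sinkD, sourceP, arrowD] <;> rfl

theorem sourceMatrix_eq (β : I₁) : sourceMatrix q β =
    (fromBlocks (C.sourceM q β) (C.sourceP q β) (C.sourceC q β) (C.sourceD q β)).submatrix
      (C.sourceEquiv β).symm (C.e (inr β)).symm := by
  ext i j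
  obtain ⟨i, rfl⟩ := (C.sourceEquiv β).surjective i
  obtain ⟨j, rfl⟩ := (C.e (inr β)).surjective j
  rcases i with i | ⟨α, h, i⟩ <;> rcases j with j | j <;>
    simp [sourceM, sinkN, sourceC, sourceD, sourceP, arrowD] <;> rfl

/-- Both sides are the upper left block of `y_h`. This compatibility is what allows one matrix
`arrowZ` to satisfy both of its defining identities. -/
theorem sinkM_inr {β : I₁} {α : I₀} (h : Ω β α) :
    (C.sinkM q α).submatrix id (sinkIncl v₀ w h) =
      (C.sourceM q β).submatrix (sourceIncl v₀ w h) id :=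
  rfl

-- The other blocks of the `A_i` are assembled from pieces of these five families.
variable {q} in
theorem ext_blocks {q' : RepSpace Ω w} (h₁ : ∀ α, C.sinkM q α = C.sinkM q' α)
    (h₂ : ∀ β, C.sourceM q β = C.sourceM q' β) (h₃ : ∀ α, C.sinkN q α = C.sinkN q' α)
    (h₄ : ∀ β, C.sourceP q β = C.sourceP q' β)
    (h₅ : ∀ β α h, C.arrowD q β α h = C.arrowD q' β α h) : q = q' := by
  have hs : ∀ α, sinkMatrix q α = sinkMatrix q' α := by
    intro α
    rw [C.sinkMatrix_eq, C.sinkMatrix_eq]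
    simp only [sinkB, sinkD, h₁, h₃, h₄, h₅]
  have ht : ∀ β, sourceMatrix q β = sourceMatrix q' β := by
    intro β
    rw [C.sourceMatrix_eq, C.sourceMatrix_eq]
    simp only [sourceC, sourceD, h₂, h₃, h₄, h₅]
  refine Prod.ext (funext fun α => ?_) (Prod.ext (funext fun β => ?_) (funext fun β => funext
    fun α => funext fun h => ?_))
  · ext i j
    exact congrFun (congrFun (hs α) i) (inl j)
  · ext i j
    exact congrFun (congrFun (ht β) (inl i)) j
  · ext i j
    exact congrFun (congrFun (hs α) i) (inr ⟨β, h, j⟩)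

/-- The representation with the same upper left blocks as `q` and given other blocks. -/
def assemble (N : ∀ α : I₀, Matrix (Fin (wP.dim (inl α))) (SinkIndex Ω (coreDim v₀ w) α) ℂ)
    (P : ∀ β : I₁, Matrix (SourceIndex Ω (coreDim v₀ w) β) (Fin (wP.dim (inr β))) ℂ)
    (D : ∀ (β : I₁) (α : I₀), Ω β α → Matrix (Fin (wP.dim (inl α))) (Fin (wP.dim (inr β))) ℂ) :
    RepSpace Ω w :=
  (fun α => (fromRows ((C.sinkM q α).submatrix id inl) ((N α).submatrix id inl)).submatrix
    (C.e (inl α)).symm id,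
   fun β => (fromCols ((C.sourceM q β).submatrix inl id) ((P β).submatrix inl id)).submatrix
    id (C.e (inr β)).symm,
   fun β α h => (fromBlocks ((C.sinkM q α).submatrix id fun j => inr ⟨β, h, j⟩)
    ((P β).submatrix (fun i => inr ⟨α, h, i⟩) id) ((N α).submatrix id fun j => inr ⟨β, h, j⟩)
    (D β α h)).submatrix (C.e (inl α)).symm (C.e (inr β)).symm)

section Assemble

variable (N : ∀ α : I₀, Matrix (Fin (wP.dim (inl α))) (SinkIndex Ω (coreDim v₀ w) α) ℂ)
    (P : ∀ β : I₁, Matrix (SourceIndex Ω (coreDim v₀ w) β) (Fin (wP.dim (inr β))) ℂ)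
    (D : ∀ (β : I₁) (α : I₀), Ω β α → Matrix (Fin (wP.dim (inl α))) (Fin (wP.dim (inr β))) ℂ)

@[simp]
theorem sinkM_assemble (α : I₀) : C.sinkM (C.assemble q N P D) α = C.sinkM q α := by
  ext i (j | ⟨β, h, j⟩) <;>
    simp [sinkM, sinkMatrix, assemble, sinkEquiv]

@[simp]
theorem sinkN_assemble (α : I₀) : C.sinkN (C.assemble q N P D) α = N α := by
  ext i (j | ⟨β, h, j⟩) <;>
    simp [sinkN, sinkMatrix, assemble, sinkEquiv]

@[simp]
theorem sourceM_assemble (β : I₁) : C.sourceM (C.assemble q N P D) β = C.sourceM q β := by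
  ext (i | ⟨α, h, i⟩) j <;>
    simp [sourceM, sinkM, sinkMatrix, sourceMatrix, assemble, sourceEquiv, sinkEquiv]

@[simp]
theorem sourceP_assemble (β : I₁) : C.sourceP (C.assemble q N P D) β = P β := by
  ext (i | ⟨α, h, i⟩) j <;>
    simp [sourceP, sourceMatrix, assemble, sourceEquiv]

@[simp]
theorem arrowD_assemble (β : I₁) (α : I₀) (h : Ω β α) :
    C.arrowD (C.assemble q N P D) β α h = D β α h := by
  ext i j
  simp [arrowD, assemble]

end Assemble

/-- The open set where the chosen maximal minors of the upper left blocks are invertible. -/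
def domain : Set (RepSpace Ω w) :=
  {q | (∀ α, (minor (C.fSink α) (C.sinkM q α)).det ≠ 0) ∧
    ∀ β, (minor (C.fSource β) (C.sourceM q β)ᵀ).det ≠ 0}

/-- A right inverse of `sinkM`. -/
noncomputable def sinkS (α : I₀) : Matrix (SinkIndex Ω (coreDim v₀ w) α) (Fin (v₀ (inl α))) ℂ :=
  minorSection (C.fSink α) (C.sinkM q α)

/-- A basis of the kernel of `sinkM`. -/
noncomputable def sinkK (α : I₀) :
    Matrix (SinkIndex Ω (coreDim v₀ w) α) (Fin (wP.dim' (inl α))) ℂ :=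
  minorKernel (C.fSink α) (C.sinkM q α)

/-- A left inverse of `sinkK`. -/
def sinkT (α : I₀) : Matrix (Fin (wP.dim' (inl α))) (SinkIndex Ω (coreDim v₀ w) α) ℂ :=
  minorCoord (C.fSink α)

/-- A left inverse of `sourceM`. -/
noncomputable def sourceR (β : I₁) :
    Matrix (Fin (v₀ (inr β))) (SourceIndex Ω (coreDim v₀ w) β) ℂ :=
  (minorSection (C.fSource β) (C.sourceM q β)ᵀ)ᵀ

/-- A projection to the cokernel of `sourceM`. -/
noncomputable def sourceQ (β : I₁) :
    Matrix (Fin (wP.dim' (inr β))) (SourceIndex Ω (coreDim v₀ w) β) ℂ :=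
  (minorKernel (C.fSource β) (C.sourceM q β)ᵀ)ᵀ

/-- A right inverse of `sourceQ`. -/
def sourceJ (β : I₁) : Matrix (SourceIndex Ω (coreDim v₀ w) β) (Fin (wP.dim' (inr β))) ℂ :=
  (minorCoord (C.fSource β))ᵀ

end Blocks

variable [Fintype I₀] [Fintype I₁] [∀ β α, Fintype (Ω β α)] {q : RepSpace Ω w}

section Identities

theorem sinkM_mul_sinkS (hq : q ∈ C.domain) (α : I₀) : C.sinkM q α * C.sinkS q α = 1 :=
  mul_minorSection (hq.1 α)

theorem sinkT_mul_sinkK (q : RepSpace Ω w) (α : I₀) : C.sinkT α * C.sinkK q α = 1 :=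
  minorCoord_mul_minorKernel

open scoped Classical in
theorem sinkS_mul_add (hq : q ∈ C.domain) (α : I₀) :
    C.sinkS q α * C.sinkM q α + C.sinkK q α * C.sinkT α = 1 :=
  minorSection_mul_add (hq.1 α)

theorem sourceR_mul_sourceM (hq : q ∈ C.domain) (β : I₁) :
    C.sourceR q β * C.sourceM q β = 1 := by
  rw [← transpose_inj, transpose_mul, sourceR, transpose_transpose, mul_minorSection (hq.2 β),
    transpose_one]

theorem sourceQ_mul_sourceM (hq : q ∈ C.domain) (β : I₁) :
    C.sourceQ q β * C.sourceM q β = 0 := by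
  rw [← transpose_inj, transpose_mul, sourceQ, transpose_transpose, mul_minorKernel (hq.2 β),
    transpose_zero]

theorem sourceQ_mul_sourceJ (q : RepSpace Ω w) (β : I₁) : C.sourceQ q β * C.sourceJ β = 1 := by
  rw [sourceQ, sourceJ, ← transpose_mul, minorCoord_mul_minorKernel, transpose_one]

open scoped Classical in
theorem sourceM_mul_add (hq : q ∈ C.domain) (β : I₁) :
    C.sourceM q β * C.sourceR q β + C.sourceJ β * C.sourceQ q β = 1 := by
  rw [← transpose_inj, transpose_add, transpose_mul, transpose_mul, transpose_one, sourceR,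
    sourceQ, sourceJ, transpose_transpose, transpose_transpose, transpose_transpose,
    minorSection_mul_add (hq.2 β)]

end Identities

open scoped Classical in
/-- A map that lifts the `h`-component of the target of `sourceM` along `sinkM`, and extends the
inclusion of the `h`-component of the source of `sinkM` along `sourceM`. -/
noncomputable def arrowZ (q : RepSpace Ω w) {β : I₁} {α : I₀} (h : Ω β α) :
    Matrix (SinkIndex Ω (coreDim v₀ w) α) (SourceIndex Ω (coreDim v₀ w) β) ℂ :=
  C.sinkS q α * (1 : Matrix (SourceIndex Ω (coreDim v₀ w) β) _ ℂ).submatrix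
      (sourceIncl v₀ w h) id
    + (1 : Matrix (SinkIndex Ω (coreDim v₀ w) α) _ ℂ).submatrix id (sinkIncl v₀ w h)
      * C.sourceR q β
    - C.sinkS q α * (C.sinkM q α).submatrix id (sinkIncl v₀ w h) * C.sourceR q β

-- Since `M_α S = 1`, the last two terms of `arrowZ` cancel after multiplication by `M_α`.
open scoped Classical in
theorem sinkM_mul_arrowZ (hq : q ∈ C.domain) {β : I₁} {α : I₀} (h : Ω β α) :
    C.sinkM q α * C.arrowZ q h = (1 : Matrix (SourceIndex Ω (coreDim v₀ w) β) _ ℂ).submatrix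
      (sourceIncl v₀ w h) id := by
  rw [arrowZ, Matrix.mul_sub, Matrix.mul_add, ← Matrix.mul_assoc, ← Matrix.mul_assoc,
    ← Matrix.mul_assoc, ← Matrix.mul_assoc, C.sinkM_mul_sinkS hq, Matrix.one_mul, Matrix.one_mul,
    mul_one_submatrix, add_sub_cancel_right]

-- Since `R M_β = 1`, the middle term gives the inclusion, and the outer terms cancel by
-- `sinkM_inr`.
open scoped Classical in
theorem arrowZ_mul_sourceM (hq : q ∈ C.domain) {β : I₁} {α : I₀} (h : Ω β α) :
    C.arrowZ q h * C.sourceM q β = (1 : Matrix (SinkIndex Ω (coreDim v₀ w) α) _ ℂ).submatrix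
      id (sinkIncl v₀ w h) := by
  rw [arrowZ, Matrix.sub_mul, Matrix.add_mul, Matrix.mul_assoc, Matrix.mul_assoc, Matrix.mul_assoc,
    C.sourceR_mul_sourceM hq, Matrix.mul_one, Matrix.mul_one, one_submatrix_mul, C.sinkM_inr,
    add_sub_cancel_left]

/-- The component of a representation along the transversal slice. -/
noncomputable def perp (q : RepSpace Ω w) : RepSpace Ω wP :=
  (fun α => C.sinkN q α * C.sinkK q α, fun β => C.sourceQ q β * C.sourceP q β,
    fun β α h => C.arrowD q β α h - C.sinkN q α * C.arrowZ q h * C.sourceP q β)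

/-- The representation in the zero fibre of `perp` corresponding to `q`. -/
noncomputable def base (q : RepSpace Ω w) : RepSpace Ω w :=
  C.assemble q (fun α => C.sinkN q α - C.sinkN q α * C.sinkK q α * C.sinkT α)
    (fun β => C.sourceP q β - C.sourceJ β * (C.sourceQ q β * C.sourceP q β))
    fun β α h => (C.sinkN q α - C.sinkN q α * C.sinkK q α * C.sinkT α) * C.arrowZ q h *
      (C.sourceP q β - C.sourceJ β * (C.sourceQ q β * C.sourceP q β))

/-- The representation with given `base` and `perp`. -/
noncomputable def glue (q : RepSpace Ω w) (r : RepSpace Ω wP) : RepSpace Ω w :=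
  C.assemble q (fun α => C.sinkN q α + r.1 α * C.sinkT α)
    (fun β => C.sourceP q β + C.sourceJ β * r.2.1 β)
    fun β α h => r.2.2 β α h + (C.sinkN q α + r.1 α * C.sinkT α) * C.arrowZ q h *
      (C.sourceP q β + C.sourceJ β * r.2.1 β)

section Assemble

variable (q)
variable (N : ∀ α : I₀, Matrix (Fin (wP.dim (inl α))) (SinkIndex Ω (coreDim v₀ w) α) ℂ)
    (P : ∀ β : I₁, Matrix (SourceIndex Ω (coreDim v₀ w) β) (Fin (wP.dim (inr β))) ℂ)
    (D : ∀ (β : I₁) (α : I₀), Ω β α → Matrix (Fin (wP.dim (inl α))) (Fin (wP.dim (inr β))) ℂ)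

theorem assemble_mem_domain : C.assemble q N P D ∈ C.domain ↔ q ∈ C.domain := by
  simp [domain]

-- The auxiliary matrices depend only on the upper left blocks, which `assemble` keeps. Thus `q`,
-- `base q` and `glue q r` share the same `Z_h`, kernel bases and cokernel projections.
@[simp]
theorem arrowZ_assemble {β : I₁} {α : I₀} (h : Ω β α) :
    C.arrowZ (C.assemble q N P D) h = C.arrowZ q h := by
  simp [arrowZ, sinkS, sourceR]

@[simp]
theorem sinkK_assemble (α : I₀) : C.sinkK (C.assemble q N P D) α = C.sinkK q α := by
  simp [sinkK]

@[simp]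
theorem sourceQ_assemble (β : I₁) : C.sourceQ (C.assemble q N P D) β = C.sourceQ q β := by
  simp [sourceQ]

end Assemble

theorem perp_eq_zero_iff : C.perp q = 0 ↔ (∀ α, C.sinkN q α * C.sinkK q α = 0) ∧
    (∀ β, C.sourceQ q β * C.sourceP q β = 0) ∧
    ∀ β α h, C.arrowD q β α h = C.sinkN q α * C.arrowZ q h * C.sourceP q β := by
  simp only [perp, Prod.ext_iff, funext_iff, Prod.fst_zero, Prod.snd_zero, Pi.zero_apply,
    sub_eq_zero]

/-- The corrections in `base` remove exactly the slice component because `T K = 1` and `Q J = 1`. -/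
theorem perp_base (q : RepSpace Ω w) : C.perp (C.base q) = 0 := by
  rw [perp_eq_zero_iff]
  refine ⟨fun α => ?_, fun β => ?_, fun β α h => ?_⟩
  · simp only [base, sinkN_assemble, sinkK_assemble]
    rw [Matrix.sub_mul, Matrix.mul_assoc (_ * _), C.sinkT_mul_sinkK, Matrix.mul_one, sub_self]
  · simp only [base, sourceP_assemble, sourceQ_assemble]
    rw [Matrix.mul_sub, ← Matrix.mul_assoc (C.sourceQ q β) (C.sourceJ β), C.sourceQ_mul_sourceJ,
      Matrix.one_mul, sub_self]
  · simp [base]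

theorem perp_glue {r : RepSpace Ω wP} (hq : C.perp q = 0) : C.perp (C.glue q r) = r := by
  obtain ⟨h₁, h₂, h₃⟩ := C.perp_eq_zero_iff.1 hq
  refine Prod.ext (funext fun α => ?_) (Prod.ext (funext fun β => ?_) (funext fun β => funext
    fun α => funext fun h => ?_))
  · simp only [perp, glue, sinkN_assemble, sinkK_assemble]
    rw [Matrix.add_mul, h₁, zero_add, Matrix.mul_assoc, C.sinkT_mul_sinkK, Matrix.mul_one]
  · simp only [perp, glue, sourceP_assemble, sourceQ_assemble]
    rw [Matrix.mul_add, h₂, zero_add, ← Matrix.mul_assoc, C.sourceQ_mul_sourceJ, Matrix.one_mul]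
  · simp [perp, glue]

theorem base_glue {r : RepSpace Ω wP} (hq : C.perp q = 0) : C.base (C.glue q r) = q := by
  obtain ⟨h₁, h₂, h₃⟩ := C.perp_eq_zero_iff.1 hq
  have hN : ∀ α, C.sinkN (C.base (C.glue q r)) α = C.sinkN q α := by
    intro α
    simp only [base, glue, sinkN_assemble, sinkK_assemble]
    rw [Matrix.add_mul _ _ (C.sinkK q α), h₁, zero_add, Matrix.mul_assoc _ _ (C.sinkK q α),
      C.sinkT_mul_sinkK, Matrix.mul_one, add_sub_cancel_right]
  have hP : ∀ β, C.sourceP (C.base (C.glue q r)) β = C.sourceP q β := by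
    intro β
    simp only [base, glue, sourceP_assemble, sourceQ_assemble]
    rw [Matrix.mul_add (C.sourceQ q β), h₂, zero_add, ← Matrix.mul_assoc (C.sourceQ q β),
      C.sourceQ_mul_sourceJ, Matrix.one_mul, add_sub_cancel_right]
  refine C.ext_blocks (fun α => by simp [base, glue]) (fun β => by simp [base, glue]) hN hP ?_
  intro β α h
  -- The `D`-block of any `base` is `N Z P` in its own `N` and `P`, and so is that of `q` by `h₃`;
  -- equality of `N` and `P` therefore suffices.
  have h₄ : C.arrowD (C.base (C.glue q r)) β α h = C.sinkN (C.base (C.glue q r)) α *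
      C.arrowZ q h * C.sourceP (C.base (C.glue q r)) β := by
    simp [base, glue]
  rw [h₄, hN, hP, h₃]

theorem base_eq_self (hq : C.perp q = 0) : C.base q = q := by
  obtain ⟨h₁, h₂, h₃⟩ := C.perp_eq_zero_iff.1 hq
  exact C.ext_blocks (fun α => by simp [base]) (fun β => by simp [base])
    (fun α => by simp [base, h₁]) (fun β => by simp [base, h₂])
    fun β α h => by simp [base, h₁, h₂, h₃]

theorem glue_base_perp (q : RepSpace Ω w) : C.glue (C.base q) (C.perp q) = q := by
  refine C.ext_blocks (fun α => by simp [base, glue]) (fun β => by simp [base, glue])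
    (fun α => by simp [base, glue, perp]) (fun β => by simp [base, glue, perp]) fun β α h => ?_
  simp [base, glue, perp]

theorem base_mem_domain : C.base q ∈ C.domain ↔ q ∈ C.domain :=
  C.assemble_mem_domain ..

theorem glue_mem_domain {r : RepSpace Ω wP} : C.glue q r ∈ C.domain ↔ q ∈ C.domain :=
  C.assemble_mem_domain ..

end SliceChart

end QuiverVariety

/-! ### The reduction maps to the slice and the rank formula -/

namespace QuiverVariety

open Sum Matrix

theorem range_mulVecLin_mul_le {l m n : Type*} [Fintype m] [Fintype n] (A : Matrix l m ℂ)
    (B : Matrix m n ℂ) : LinearMap.range (A * B).mulVecLin ≤ LinearMap.range A.mulVecLin := by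
  rw [mulVecLin_mul]
  exact LinearMap.range_comp_le_range _ _

theorem map_range_mulVecLin {l m n : Type*} [Fintype m] [Fintype n] (A : Matrix l m ℂ)
    (B : Matrix m n ℂ) :
    (LinearMap.range B.mulVecLin).map A.mulVecLin = LinearMap.range (A * B).mulVecLin := by
  rw [mulVecLin_mul, LinearMap.range_comp]

theorem mul_submatrix_id {l m n o : Type*} [Fintype m] (A : Matrix l m ℂ) (B : Matrix m n ℂ)
    (f : o → n) : A * B.submatrix id f = (A * B).submatrix id f :=
  rfl

namespace SliceChart

variable {I₀ I₁ : Type*} {Ω : I₁ → I₀ → Type*} {v₀ : I₀ ⊕ I₁ → ℕ} {w wP : FrameDim (I₀ ⊕ I₁)}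
  (C : SliceChart Ω v₀ w wP) [Fintype I₀] [Fintype I₁] [∀ β α, Fintype (Ω β α)]

section Definitions

variable (q : RepSpace Ω w)

/-- The products `N_α Z_h`, stacked vertically. -/
noncomputable def sourceNZ (β : I₁) : Matrix (Σ (α : I₀) (_ : Ω β α), Fin (wP.dim (inl α)))
    (SourceIndex Ω (coreDim v₀ w) β) ℂ :=
  Matrix.of fun x j => (C.sinkN q x.1 * C.arrowZ q x.2.1) x.2.2 j

/-- The products `Z_h P_β`, side by side. -/
noncomputable def sinkZP (α : I₀) : Matrix (SinkIndex Ω (coreDim v₀ w) α)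
    (Σ (β : I₁) (_ : Ω β α), Fin (wP.dim (inr β))) ℂ :=
  Matrix.of fun i x => (C.arrowZ q x.2.1 * C.sourceP q x.1) i x.2.2

/-- The projection `W_α → W_α^⊥`. -/
noncomputable def sinkRed (α : I₀) : Matrix (Fin (wP.dim (inl α))) (Fin (w.dim (inl α))) ℂ :=
  (fromCols (-(C.sinkN q α * C.sinkS q α)) 1).submatrix id (C.e (inl α)).symm

/-- A basis of the kernel of `sinkRed`. -/
noncomputable def sinkKer (α : I₀) : Matrix (Fin (w.dim (inl α))) (Fin (v₀ (inl α))) ℂ :=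
  (fromRows 1 (C.sinkN q α * C.sinkS q α)).submatrix (C.e (inl α)).symm id

/-- A section of `sinkRed`. -/
def sinkLift (α : I₀) : Matrix (Fin (w.dim (inl α))) (Fin (wP.dim (inl α))) ℂ :=
  (fromRows (0 : Matrix (Fin (v₀ (inl α))) (Fin (wP.dim (inl α))) ℂ) 1).submatrix
    (C.e (inl α)).symm id

open scoped Classical in
/-- The projection from the target of `A_β` to the target of its analogue for `w^⊥`. -/
noncomputable def sourceRed (β : I₁) : Matrix (SourceIndex Ω wP β) (SourceIndex Ω w β) ℂ :=
  (fromBlocks (C.sourceQ q β) 0 (-C.sourceNZ q β) 1).submatrix id (C.sourceEquiv β).symm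

/-- A basis of the kernel of `sourceRed`. -/
noncomputable def sourceKer (β : I₁) : Matrix (SourceIndex Ω w β) (Fin (v₀ (inr β))) ℂ :=
  (fromRows (C.sourceM q β) (C.sourceC q β)).submatrix (C.sourceEquiv β).symm id

open scoped Classical in
/-- A section of `sourceRed`. -/
noncomputable def sourceLift (β : I₁) : Matrix (SourceIndex Ω w β) (SourceIndex Ω wP β) ℂ :=
  (fromBlocks (C.sourceJ β) 0 (C.sourceNZ q β * C.sourceJ β) 1).submatrix
    (C.sourceEquiv β).symm id

end Definitions

variable {q : RepSpace Ω w}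

/-- The `h`-part of `C_β` is `N_α` on the `h`-component, and `Z_h M_β` is the inclusion of that
component. -/
theorem sourceNZ_mul_sourceM (hq : q ∈ C.domain) (β : I₁) :
    C.sourceNZ q β * C.sourceM q β = C.sourceC q β := by
  ext ⟨α, h, i⟩ j
  have : C.sinkN q α * C.arrowZ q h * C.sourceM q β =
      (C.sinkN q α).submatrix id (sinkIncl v₀ w h) := by
    classical
    rw [Matrix.mul_assoc, C.arrowZ_mul_sourceM hq, mul_one_submatrix]
  exact congrFun (congrFun this i) j

/-- The dual computation: the `h`-part of `B_α` is the `h`-component of `P_β`, and `M_α Z_h` is the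
projection to that component. -/
theorem sinkM_mul_sinkZP (hq : q ∈ C.domain) (α : I₀) :
    C.sinkM q α * C.sinkZP q α = C.sinkB q α := by
  ext i ⟨β, h, k⟩
  have : C.sinkM q α * (C.arrowZ q h * C.sourceP q β) =
      (C.sourceP q β).submatrix (sourceIncl v₀ w h) id := by
    classical
    rw [← Matrix.mul_assoc, C.sinkM_mul_arrowZ hq, one_submatrix_mul]
  exact congrFun (congrFun this i) k

theorem sinkMatrix_perp (q : RepSpace Ω w) (α : I₀) : sinkMatrix (C.perp q) α =
    fromCols (C.sinkN q α * C.sinkK q α) (C.sinkD q α - C.sinkN q α * C.sinkZP q α) := by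
  ext i (j | ⟨β, h, k⟩)
  · rfl
  · change C.arrowD q β α h i k - (C.sinkN q α * C.arrowZ q h * C.sourceP q β) i k = _
    rw [Matrix.mul_assoc]
    rfl

theorem sourceMatrix_perp (q : RepSpace Ω w) (β : I₁) : sourceMatrix (C.perp q) β =
    fromRows (C.sourceQ q β * C.sourceP q β)
      (C.sourceD q β - C.sourceNZ q β * C.sourceP q β) := by
  ext (j | ⟨α, h, k⟩) i <;> rfl

theorem splitExact_sink (q : RepSpace Ω w) (α : I₀) :
    SplitExact (C.sinkKer q α) (C.sinkRed q α) (C.sinkLift α)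
      ((fromCols 1 0).submatrix id (C.e (inl α)).symm) where
  R_mul_G := by
    rw [sinkRed, sinkKer, submatrix_symm_mul_submatrix_symm, fromCols_mul_fromRows]
    simp
  R_mul_σ := by
    rw [sinkRed, sinkLift, submatrix_symm_mul_submatrix_symm, fromCols_mul_fromRows]
    simp
  τ_mul_G := by
    rw [sinkKer, submatrix_symm_mul_submatrix_symm, fromCols_mul_fromRows]
    simp
  add_eq := by
    rw [sinkRed, sinkKer, sinkLift, ← submatrix_mul _ _ _ _ _ Function.bijective_id,
      ← submatrix_mul _ _ _ _ _ Function.bijective_id, fromRows_mul_fromCols,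
      fromRows_mul_fromCols]
    refine (congrFun (congrFun (submatrix_add _ _) _) _).symm.trans ?_
    rw [fromBlocks_add]
    simp [fromBlocks_one]

open scoped Classical in
theorem splitExact_source (hq : q ∈ C.domain) (β : I₁) :
    SplitExact (C.sourceKer q β) (C.sourceRed q β) (C.sourceLift q β)
      ((fromCols (C.sourceR q β) 0).submatrix id (C.sourceEquiv β).symm) where
  R_mul_G := by
    rw [sourceRed, sourceKer, submatrix_symm_mul_submatrix_symm, fromBlocks_mul_fromRows,
      C.sourceQ_mul_sourceM hq, Matrix.neg_mul, C.sourceNZ_mul_sourceM hq]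
    simp
  R_mul_σ := by
    rw [sourceRed, sourceLift, submatrix_symm_mul_submatrix_symm, fromBlocks_multiply,
      C.sourceQ_mul_sourceJ]
    simp [fromBlocks_one]
  τ_mul_G := by
    rw [sourceKer, submatrix_symm_mul_submatrix_symm, fromCols_mul_fromRows,
      C.sourceR_mul_sourceM hq]
    simp
  add_eq := by
    -- With `C_β = (NZ) M_β` the off-diagonal block is `NZ (M R + J Q - 1)`, which vanishes.
    have h1 : C.sourceC q β * C.sourceR q β +
        (C.sourceNZ q β * C.sourceJ β * C.sourceQ q β + -C.sourceNZ q β) = 0 := by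
      rw [← C.sourceNZ_mul_sourceM hq, ← add_assoc, Matrix.mul_assoc, Matrix.mul_assoc,
        ← Matrix.mul_add, C.sourceM_mul_add hq, Matrix.mul_one, add_neg_cancel]
    rw [sourceRed, sourceKer, sourceLift, ← submatrix_mul _ _ _ _ _ Function.bijective_id,
      ← submatrix_mul _ _ _ _ _ Function.bijective_id, fromRows_mul_fromCols, fromBlocks_multiply]
    refine (congrFun (congrFun (submatrix_add _ _) _) _).symm.trans ?_
    rw [fromBlocks_add]
    simp only [Matrix.zero_mul, Matrix.mul_zero, Matrix.one_mul, Matrix.mul_one, add_zero,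
      zero_add, C.sourceM_mul_add hq, h1]
    simp [fromBlocks_one]

/-- The kernel of the reduction is the image under `A_α` of the section `S`, so it lies in every
`X_α` containing `im A_α`. -/
theorem range_sinkKer_le (hq : q ∈ C.domain) (α : I₀) :
    LinearMap.range (C.sinkKer q α).mulVecLin ≤ LinearMap.range (sinkMatrix q α).mulVecLin := by
  have : C.sinkKer q α = sinkMatrix q α *
      (fromRows (C.sinkS q α) 0).submatrix (C.sinkEquiv α).symm id := by
    rw [C.sinkMatrix_eq, submatrix_mul_equiv, fromBlocks_mul_fromRows, C.sinkM_mul_sinkS hq]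
    simp [sinkKer]
  rw [this]
  exact range_mulVecLin_mul_le _ _

theorem range_sourceKer_le (q : RepSpace Ω w) (β : I₁) :
    LinearMap.range (C.sourceKer q β).mulVecLin ≤ LinearMap.range (sourceMatrix q β).mulVecLin := by
  have : C.sourceKer q β = sourceMatrix q β *
      (fromRows (1 : Matrix (Fin (v₀ (inr β))) (Fin (v₀ (inr β))) ℂ)
        (0 : Matrix (Fin (wP.dim (inr β))) (Fin (v₀ (inr β))) ℂ)).submatrix
          (C.e (inr β)).symm id := by
    rw [C.sourceMatrix_eq, submatrix_mul_equiv, fromBlocks_mul_fromRows]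
    simp [sourceKer]
  rw [this]
  exact range_mulVecLin_mul_le _ _

/-- Row reduction by `N S`: expand `N = N (S M + K T)` and substitute `B = M (ZP)`. What is left
differs from the slice matrix by column operations only. -/
theorem sinkRed_mul_sinkMatrix (hq : q ∈ C.domain) (α : I₀) :
    C.sinkRed q α * sinkMatrix q α = (fromCols (C.sinkN q α * C.sinkK q α * C.sinkT α)
      (C.sinkD q α - C.sinkN q α * C.sinkZP q α +
        C.sinkN q α * C.sinkK q α * C.sinkT α * C.sinkZP q α)).submatrix id
        (C.sinkEquiv α).symm := by
  classical
  have h1 : C.sinkN q α = C.sinkN q α * C.sinkS q α * C.sinkM q α +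
      C.sinkN q α * C.sinkK q α * C.sinkT α := by
    rw [Matrix.mul_assoc, Matrix.mul_assoc, ← Matrix.mul_add, C.sinkS_mul_add hq, Matrix.mul_one]
  have h2 : C.sinkN q α * C.sinkZP q α = C.sinkN q α * C.sinkS q α * C.sinkB q α +
      C.sinkN q α * C.sinkK q α * C.sinkT α * C.sinkZP q α := by
    nth_rewrite 1 [h1]
    rw [Matrix.add_mul, Matrix.mul_assoc _ (C.sinkM q α), C.sinkM_mul_sinkZP hq]
  rw [C.sinkMatrix_eq, sinkRed, submatrix_mul_equiv, fromCols_mul_fromBlocks, h2]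
  congr 2
  · rw [Matrix.neg_mul, Matrix.one_mul, neg_add_eq_iff_eq_add]
    exact h1
  · rw [Matrix.neg_mul, Matrix.one_mul]; abel

/-- The two matrices factor through each other: from the slice matrix by `T, T(ZP)` over `0, 1`, and
back by `K, -ZP` over `0, 1`, using `T K = 1`. -/
theorem map_sinkRed_range (hq : q ∈ C.domain) (α : I₀) :
    (LinearMap.range (sinkMatrix q α).mulVecLin).map (C.sinkRed q α).mulVecLin =
      LinearMap.range (sinkMatrix (C.perp q) α).mulVecLin := by
  classical
  rw [map_range_mulVecLin]
  refine le_antisymm ?_ ?_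
  · have : C.sinkRed q α * sinkMatrix q α = sinkMatrix (C.perp q) α *
        (fromBlocks (C.sinkT α) (C.sinkT α * C.sinkZP q α) 0
          (1 : Matrix (Σ (β : I₁) (_ : Ω β α), Fin (wP.dim (inr β))) _ ℂ) :
          Matrix (SinkIndex Ω wP α) _ ℂ).submatrix id (C.sinkEquiv α).symm := by
      rw [C.sinkRed_mul_sinkMatrix hq, C.sinkMatrix_perp]
      rw [mul_submatrix_id, fromCols_mul_fromBlocks]
      congr 2
      · simp
      · rw [Matrix.mul_one, ← Matrix.mul_assoc, add_comm]
    rw [this]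
    exact range_mulVecLin_mul_le _ _
  · have : sinkMatrix (C.perp q) α = C.sinkRed q α * sinkMatrix q α *
        (fromBlocks (C.sinkK q α) (-C.sinkZP q α) 0 1).submatrix (C.sinkEquiv α).symm id := by
      rw [C.sinkRed_mul_sinkMatrix hq, C.sinkMatrix_perp, submatrix_symm_mul_submatrix_symm,
        fromCols_mul_fromBlocks]
      congr 1
      · rw [Matrix.mul_assoc _ (C.sinkT α), C.sinkT_mul_sinkK]
        simp
      · rw [Matrix.mul_neg, Matrix.mul_one]; abel
    rw [this]
    exact range_mulVecLin_mul_le _ _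

/-- `sourceRed` kills the first block column of `A_β`, and the second becomes the slice matrix
itself. -/
theorem map_sourceRed_range (hq : q ∈ C.domain) (β : I₁) :
    (LinearMap.range (sourceMatrix q β).mulVecLin).map (C.sourceRed q β).mulVecLin =
      LinearMap.range (sourceMatrix (C.perp q) β).mulVecLin := by
  classical
  have h1 : C.sourceRed q β * sourceMatrix q β =
      (fromCols 0 (sourceMatrix (C.perp q) β)).submatrix id (C.e (inr β)).symm := by
    rw [C.sourceMatrix_eq, sourceRed, submatrix_mul_equiv, fromBlocks_multiply,
      C.sourceQ_mul_sourceM hq, Matrix.neg_mul, C.sourceNZ_mul_sourceM hq, C.sourceMatrix_perp]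
    ext (i | i) j <;> obtain ⟨j | j, rfl⟩ := (C.e (inr β)).surjective j <;>
      simp [sub_eq_neg_add]
  rw [map_range_mulVecLin]
  refine le_antisymm ?_ ?_
  · have : C.sourceRed q β * sourceMatrix q β = sourceMatrix (C.perp q) β *
        (fromCols (0 : Matrix (Fin (wP.dim (inr β))) (Fin (v₀ (inr β))) ℂ)
          (1 : Matrix (Fin (wP.dim (inr β))) (Fin (wP.dim (inr β))) ℂ)).submatrix id
            (C.e (inr β)).symm := by
      rw [h1, mul_submatrix_id, mul_fromCols]
      simp
    rw [this]
    exact range_mulVecLin_mul_le _ _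
  · have : sourceMatrix (C.perp q) β = C.sourceRed q β * sourceMatrix q β *
        (fromRows (0 : Matrix (Fin (v₀ (inr β))) (Fin (wP.dim (inr β))) ℂ)
          (1 : Matrix (Fin (wP.dim (inr β))) (Fin (wP.dim (inr β))) ℂ)).submatrix
            (C.e (inr β)).symm id := by
      rw [h1, submatrix_symm_mul_submatrix_symm, fromCols_mul_fromRows]
      simp
    nth_rewrite 1 [this]
    exact range_mulVecLin_mul_le _ _

/-- The rank drops by `v₀` in passing to the slice. -/
theorem rankA_eq (hq : q ∈ C.domain) (i : I₀ ⊕ I₁) : rankA q i = v₀ i + rankA (C.perp q) i := by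
  classical
  rcases i with α | β
  · have := (C.splitExact_sink q α).finrank_map (C.range_sinkKer_le hq α)
    rw [C.map_sinkRed_range hq, Fintype.card_fin] at this
    exact this.symm
  · have := (C.splitExact_source hq β).finrank_map (C.range_sourceKer_le q β)
    rw [C.map_sourceRed_range hq, Fintype.card_fin] at this
    exact this.symm

/-- On `h`-components, `sinkRed` and `sourceRed` agree up to the image of the slice. -/
theorem sinkRed_mulVec_sub_mem (hq : q ∈ C.domain) {β : I₁} {α : I₀} (h : Ω β α)
    (ξ : SourceIndex Ω w β → ℂ) :
    (C.sinkRed q α *ᵥ fun k => ξ (inr ⟨α, h, k⟩)) -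
        (fun k => (C.sourceRed q β *ᵥ ξ) (inr ⟨α, h, k⟩)) ∈
      LinearMap.range (sinkMatrix (C.perp q) α).mulVecLin := by
  classical
  obtain ⟨ζ, rfl⟩ : ∃ ζ, ξ = ζ ∘ (C.sourceEquiv β).symm :=
    ⟨ξ ∘ C.sourceEquiv β, by ext; simp⟩
  obtain ⟨x, y, rfl⟩ : ∃ x y, ζ = Sum.elim x y := ⟨_, _, (Sum.elim_comp_inl_inr ζ).symm⟩
  have h1 : (C.sourceRed q β *ᵥ (Sum.elim x y ∘ (C.sourceEquiv β).symm)) =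
      Sum.elim (C.sourceQ q β *ᵥ x) (-(C.sourceNZ q β *ᵥ x) + y) := by
    rw [sourceRed, submatrix_mulVec_equiv]
    simp [Function.comp_assoc, fromBlocks_mulVec, neg_mulVec]
  have h2 : (fun k => (Sum.elim x y ∘ (C.sourceEquiv β).symm) (inr ⟨α, h, k⟩)) =
      Sum.elim (fun i => x (inr ⟨α, h, i⟩)) (fun i => y ⟨α, h, i⟩) ∘ (C.e (inl α)).symm := by
    ext k
    obtain ⟨k | k, rfl⟩ := (C.e (inl α)).surjective k <;> simp [sourceEquiv]
  have h3 : (fun i : Fin (v₀ (inl α)) => x (inr ⟨α, h, i⟩)) =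
      C.sinkM q α *ᵥ (C.arrowZ q h *ᵥ x) := by
    rw [mulVec_mulVec, C.sinkM_mul_arrowZ hq]
    ext i
    simp [mulVec, dotProduct, one_apply]
  have h4 : C.sinkN q α = C.sinkN q α * C.sinkS q α * C.sinkM q α +
      C.sinkN q α * C.sinkK q α * C.sinkT α := by
    rw [Matrix.mul_assoc, Matrix.mul_assoc, ← Matrix.mul_add, C.sinkS_mul_add hq, Matrix.mul_one]
  have h5 : (fun k => (C.sourceNZ q β *ᵥ x) ⟨α, h, k⟩) =
      C.sinkN q α *ᵥ (C.arrowZ q h *ᵥ x) := by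
    rw [mulVec_mulVec]; rfl
  -- With the `h`-component of `x` written as `M_α Z_h x`, the difference is `N Z_h x - N S M Z_h x
  -- = N K (T Z_h x)`, which is `N K`, the first block of the slice matrix, applied to `T Z_h x`.
  refine ⟨Sum.elim (C.sinkT α *ᵥ (C.arrowZ q h *ᵥ x)) 0, ?_⟩
  rw [h1, h2, sinkRed, submatrix_mulVec_equiv, h3, mulVecLin_apply, C.sinkMatrix_perp,
    fromCols_mulVec_sumElim]
  simp only [Function.comp_assoc, Equiv.symm_symm, Equiv.symm_comp_self, Function.comp_id,
    fromCols_mulVec_sumElim, Sum.elim_inr, mulVec_zero, add_zero, one_mulVec, neg_mulVec]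
  have h6 : (fun k => (-(C.sourceNZ q β *ᵥ x) + y) ⟨α, h, k⟩) =
      -(C.sinkN q α *ᵥ (C.arrowZ q h *ᵥ x)) + fun k => y ⟨α, h, k⟩ := by
    rw [← h5]; rfl
  have h7 := congrArg (· *ᵥ (C.arrowZ q h *ᵥ x)) h4
  simp only [add_mulVec] at h7
  rw [h6, h7]
  simp only [mulVec_mulVec, Matrix.mul_assoc]
  abel

end SliceChart

end QuiverVariety

/-! ### Regularity of images and preimages of subspaces and of all slice constructions -/

namespace SpaceWithFunctions

open Matrix

section Minor

variable {Z : Type*} [SpaceWithFunctions Z] {z : Z} {a b : ℕ} {J : Type*}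
  {e : Fin a ⊕ Fin b ≃ J} {M : Z → Matrix (Fin a) J ℂ}

theorem RegularMatrixAt.minor (hM : RegularMatrixAt M z) :
    RegularMatrixAt (fun y => minor e (M y)) z :=
  hM.submatrix _ _

theorem RegularMatrixAt.minorSection (hM : RegularMatrixAt M z)
    (h : (_root_.minor e (M z)).det ≠ 0) :
    RegularMatrixAt (fun y => minorSection e (M y)) z :=
  ((hM.minor.inv h).fromRows (.const _)).submatrix _ _

theorem RegularMatrixAt.minorKernel (hM : RegularMatrixAt M z)
    (h : (_root_.minor e (M z)).det ≠ 0) :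
    RegularMatrixAt (fun y => minorKernel e (M y)) z :=
  (((hM.minor.inv h).mul (hM.submatrix _ _)).neg.fromRows (.const _)).submatrix _ _

end Minor

section Grassmannian

variable {Z : Type*} [SpaceWithFunctions Z] {z : Z} {d d' : ℕ} {a m n : Type*} [Fintype a]
  [Fintype m] [Fintype n] [DecidableEq a] [DecidableEq m] [DecidableEq n]

/-- Images of subspaces under a regular family of linear maps vary regularly. -/
theorem MorphAt.gr_map {X : Z → Gr d m} {Y : Z → Gr d' n} {R : Z → Matrix n m ℂ}
    (hX : MorphAt X z) (hR : RegularMatrixAt R z)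
    (h : ∀ y, (Y y).space = (X y).space.map (R y).mulVecLin) : MorphAt Y z := by
  obtain ⟨g, hg, V, hV, hzV, hspan⟩ := Gr.exists_regular_span (X z)
  obtain ⟨W, hW, hzW, HW⟩ := hX.continuousAt V hV hzV
  have hgX : RegularMatrixAt (fun y => g (X y)) z := fun i j => hX.regular _ (hg i j)
  refine MorphAt.of_span (hgX.mul hR.transpose) hW hzW fun y hy => ?_
  rw [h, ← hspan _ (HW y hy), Submodule.map_span, ← Set.range_comp]
  congr 2
  ext i j
  simp only [Matrix.row, mul_apply, transpose_apply, mul_comm (g (X y) i _)]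
  rfl

/-- Preimages of subspaces under a regular family of split surjections vary regularly. -/
theorem MorphAt.gr_comap {X : Z → Gr d n} {Y : Z → Gr d' m} {G : Z → Matrix m a ℂ}
    {R : Z → Matrix n m ℂ} {σ : Z → Matrix m n ℂ} {τ : Z → Matrix a m ℂ} (hX : MorphAt X z)
    (hG : RegularMatrixAt G z) (hσ : RegularMatrixAt σ z)
    (hs : ∀ y, SplitExact (G y) (R y) (σ y) (τ y))
    (h : ∀ y, (Y y).space = (X y).space.comap (R y).mulVecLin) : MorphAt Y z := by
  obtain ⟨g, hg, V, hV, hzV, hspan⟩ := Gr.exists_regular_span (X z)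
  obtain ⟨W, hW, hzW, HW⟩ := hX.continuousAt V hV hzV
  have hgX : RegularMatrixAt (fun y => g (X y)) z := fun i j => hX.regular _ (hg i j)
  refine MorphAt.of_span (hG.transpose.fromRows (hgX.mul hσ.transpose)) hW hzW fun y hy => ?_
  rw [h, ← hspan _ (HW y hy), (hs y).comap_span]
  congr 2
  ext (i | i) j
  · simp [Matrix.row]
  · simp [mul_apply, mulVec, dotProduct, Matrix.row, mul_comm]

end Grassmannian

end SpaceWithFunctions

namespace QuiverVariety

open Sum Matrix SpaceWithFunctions

variable {I₀ I₁ : Type*} {Ω : I₁ → I₀ → Type*} {v₀ : I₀ ⊕ I₁ → ℕ} {w wP : FrameDim (I₀ ⊕ I₁)}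
  {Z : Type*} [SpaceWithFunctions Z] {z : Z} {Q : Z → RepSpace Ω w}

/-- The entries of a family of representations are regular at `z`. -/
structure RegularRepAt (Q : Z → RepSpace Ω w) (z : Z) : Prop where
  sink : ∀ α, RegularMatrixAt (fun y => (Q y).1 α) z
  source : ∀ β, RegularMatrixAt (fun y => (Q y).2.1 β) z
  arrow : ∀ β α h, RegularMatrixAt (fun y => (Q y).2.2 β α h) z

namespace RegularRepAt

theorem morphAt (hQ : RegularRepAt Q z) : MorphAt Q z :=
  MorphAt.prodMk (MorphAt.piMk fun α => (hQ.sink α).morphAt)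
    (MorphAt.prodMk (MorphAt.piMk fun β => (hQ.source β).morphAt)
      (MorphAt.piMk fun β => MorphAt.piMk fun α => MorphAt.piMk fun h => (hQ.arrow β α h).morphAt))

theorem of_morphAt (hQ : MorphAt Q z) : RegularRepAt Q z where
  sink α := .of_morphAt ((MorphAt.apply α _).comp ((MorphAt.fst _).comp hQ))
  source β := .of_morphAt ((MorphAt.apply β _).comp
    ((MorphAt.fst _).comp ((MorphAt.snd _).comp hQ)))
  arrow β α h := .of_morphAt ((MorphAt.apply h _).comp ((MorphAt.apply α _).comp
    ((MorphAt.apply β _).comp ((MorphAt.snd _).comp ((MorphAt.snd _).comp hQ)))))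

theorem sinkMatrix (hQ : RegularRepAt Q z) (α : I₀) :
    RegularMatrixAt (fun y => sinkMatrix (Q y) α) z
  | i, inl j => hQ.sink α i j
  | i, inr ⟨β, h, j⟩ => hQ.arrow β α h i j

theorem sourceMatrix (hQ : RegularRepAt Q z) (β : I₁) :
    RegularMatrixAt (fun y => sourceMatrix (Q y) β) z
  | inl i, j => hQ.source β i j
  | inr ⟨α, h, i⟩, j => hQ.arrow β α h i j

variable (C : SliceChart Ω v₀ w wP)

theorem sinkM (hQ : RegularRepAt Q z) (α : I₀) : RegularMatrixAt (fun y => C.sinkM (Q y) α) z :=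
  (hQ.sinkMatrix α).submatrix _ _

theorem sinkN (hQ : RegularRepAt Q z) (α : I₀) : RegularMatrixAt (fun y => C.sinkN (Q y) α) z :=
  (hQ.sinkMatrix α).submatrix _ _

theorem sourceM (hQ : RegularRepAt Q z) (β : I₁) :
    RegularMatrixAt (fun y => C.sourceM (Q y) β) z :=
  (hQ.sourceMatrix β).submatrix _ _

theorem sourceP (hQ : RegularRepAt Q z) (β : I₁) :
    RegularMatrixAt (fun y => C.sourceP (Q y) β) z :=
  (hQ.sourceMatrix β).submatrix _ _

theorem arrowD (hQ : RegularRepAt Q z) (β : I₁) (α : I₀) (h : Ω β α) :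
    RegularMatrixAt (fun y => C.arrowD (Q y) β α h) z :=
  (hQ.arrow β α h).submatrix _ _

theorem sourceC (hQ : RegularRepAt Q z) (β : I₁) :
    RegularMatrixAt (fun y => C.sourceC (Q y) β) z :=
  fun x j => hQ.sinkN C x.1 x.2.2 (inr ⟨β, x.2.1, j⟩)

variable {C}

theorem sinkS (hQ : RegularRepAt Q z) (hz : Q z ∈ C.domain) (α : I₀) :
    RegularMatrixAt (fun y => C.sinkS (Q y) α) z :=
  (hQ.sinkM C α).minorSection (hz.1 α)

theorem sinkK (hQ : RegularRepAt Q z) (hz : Q z ∈ C.domain) (α : I₀) :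
    RegularMatrixAt (fun y => C.sinkK (Q y) α) z :=
  (hQ.sinkM C α).minorKernel (hz.1 α)

theorem sourceR (hQ : RegularRepAt Q z) (hz : Q z ∈ C.domain) (β : I₁) :
    RegularMatrixAt (fun y => C.sourceR (Q y) β) z :=
  ((hQ.sourceM C β).transpose.minorSection (hz.2 β)).transpose

theorem sourceQ (hQ : RegularRepAt Q z) (hz : Q z ∈ C.domain) (β : I₁) :
    RegularMatrixAt (fun y => C.sourceQ (Q y) β) z :=
  ((hQ.sourceM C β).transpose.minorKernel (hz.2 β)).transpose

theorem assemble (hQ : RegularRepAt Q z)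
    {N : Z → ∀ α : I₀, Matrix (Fin (wP.dim (inl α))) (SinkIndex Ω (coreDim v₀ w) α) ℂ}
    {P : Z → ∀ β : I₁, Matrix (SourceIndex Ω (coreDim v₀ w) β) (Fin (wP.dim (inr β))) ℂ}
    {D : Z → ∀ (β : I₁) (α : I₀), Ω β α →
      Matrix (Fin (wP.dim (inl α))) (Fin (wP.dim (inr β))) ℂ}
    (hN : ∀ α, RegularMatrixAt (fun y => N y α) z) (hP : ∀ β, RegularMatrixAt (fun y => P y β) z)
    (hD : ∀ β α h, RegularMatrixAt (fun y => D y β α h) z) :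
    RegularRepAt (fun y => C.assemble (Q y) (N y) (P y) (D y)) z where
  sink α := (((hQ.sinkM C α).submatrix _ _).fromRows ((hN α).submatrix _ _)).submatrix _ _
  source β := (((hQ.sourceM C β).submatrix _ _).fromCols ((hP β).submatrix _ _)).submatrix _ _
  arrow β α h := (((hQ.sinkM C α).submatrix _ _).fromBlocks ((hP β).submatrix _ _)
    ((hN α).submatrix _ _) (hD β α h)).submatrix _ _

variable [Fintype I₀] [Fintype I₁] [∀ β α, Fintype (Ω β α)]

theorem arrowZ (hQ : RegularRepAt Q z) (hz : Q z ∈ C.domain) {β : I₁} {α : I₀} (h : Ω β α) :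
    RegularMatrixAt (fun y => C.arrowZ (Q y) h) z :=
  (((hQ.sinkS hz α).mul (.const _)).add ((RegularMatrixAt.const _).mul (hQ.sourceR hz β))).sub
    (((hQ.sinkS hz α).mul ((hQ.sinkM C α).submatrix _ _)).mul (hQ.sourceR hz β))

theorem perp (hQ : RegularRepAt Q z) (hz : Q z ∈ C.domain) :
    RegularRepAt (fun y => C.perp (Q y)) z where
  sink α := (hQ.sinkN C α).mul (hQ.sinkK hz α)
  source β := (hQ.sourceQ hz β).mul (hQ.sourceP C β)
  arrow β α h := (hQ.arrowD C β α h).sub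
    (((hQ.sinkN C α).mul (hQ.arrowZ hz h)).mul (hQ.sourceP C β))

theorem base (hQ : RegularRepAt Q z) (hz : Q z ∈ C.domain) :
    RegularRepAt (fun y => C.base (Q y)) z := by
  have hN : ∀ α, RegularMatrixAt
      (fun y => C.sinkN (Q y) α - C.sinkN (Q y) α * C.sinkK (Q y) α * C.sinkT α) z := fun α =>
    (hQ.sinkN C α).sub (((hQ.sinkN C α).mul (hQ.sinkK hz α)).mul (.const _))
  have hP : ∀ β, RegularMatrixAt
      (fun y => C.sourceP (Q y) β - C.sourceJ β * (C.sourceQ (Q y) β * C.sourceP (Q y) β)) z :=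
    fun β => (hQ.sourceP C β).sub
      ((RegularMatrixAt.const _).mul ((hQ.sourceQ hz β).mul (hQ.sourceP C β)))
  exact hQ.assemble hN hP fun β α h => ((hN α).mul (hQ.arrowZ hz h)).mul (hP β)

theorem glue (hQ : RegularRepAt Q z) (hz : Q z ∈ C.domain) {r : Z → RepSpace Ω wP}
    (hr : RegularRepAt r z) : RegularRepAt (fun y => C.glue (Q y) (r y)) z := by
  have hN : ∀ α, RegularMatrixAt (fun y => C.sinkN (Q y) α + (r y).1 α * C.sinkT α) z := fun α =>
    (hQ.sinkN C α).add ((hr.sink α).mul (.const _))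
  have hP : ∀ β, RegularMatrixAt (fun y => C.sourceP (Q y) β + C.sourceJ β * (r y).2.1 β) z :=
    fun β => (hQ.sourceP C β).add ((RegularMatrixAt.const _).mul (hr.source β))
  exact hQ.assemble hN hP fun β α h =>
    (hr.arrow β α h).add (((hN α).mul (hQ.arrowZ hz h)).mul (hP β))

theorem sourceNZ (hQ : RegularRepAt Q z) (hz : Q z ∈ C.domain) (β : I₁) :
    RegularMatrixAt (fun y => C.sourceNZ (Q y) β) z :=
  fun x j => (hQ.sinkN C x.1).mul (hQ.arrowZ hz x.2.1) x.2.2 j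

theorem sinkRed (hQ : RegularRepAt Q z) (hz : Q z ∈ C.domain) (α : I₀) :
    RegularMatrixAt (fun y => C.sinkRed (Q y) α) z :=
  (((hQ.sinkN C α).mul (hQ.sinkS hz α)).neg.fromCols (.const _)).submatrix _ _

theorem sinkKer (hQ : RegularRepAt Q z) (hz : Q z ∈ C.domain) (α : I₀) :
    RegularMatrixAt (fun y => C.sinkKer (Q y) α) z :=
  ((RegularMatrixAt.const _).fromRows ((hQ.sinkN C α).mul (hQ.sinkS hz α))).submatrix _ _

theorem sourceRed (hQ : RegularRepAt Q z) (hz : Q z ∈ C.domain) (β : I₁) :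
    RegularMatrixAt (fun y => C.sourceRed (Q y) β) z :=
  ((hQ.sourceQ hz β).fromBlocks (.const _) (hQ.sourceNZ hz β).neg (.const _)).submatrix _ _

theorem sourceKer (hQ : RegularRepAt Q z) (β : I₁) :
    RegularMatrixAt (fun y => C.sourceKer (Q y) β) z :=
  ((hQ.sourceM C β).fromRows (hQ.sourceC C β)).submatrix _ _

theorem sourceLift (hQ : RegularRepAt Q z) (hz : Q z ∈ C.domain) (β : I₁) :
    RegularMatrixAt (fun y => C.sourceLift (Q y) β) z :=
  ((RegularMatrixAt.const _).fromBlocks (.const _) ((hQ.sourceNZ hz β).mul (.const _))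
    (.const _)).submatrix _ _

/-- The domain of a slice chart is open. -/
theorem eventually_mem_domain (hQ : RegularRepAt Q z) (hz : Q z ∈ C.domain) :
    ∃ V : Set Z, IsZariskiOpen V ∧ z ∈ V ∧ ∀ y ∈ V, Q y ∈ C.domain := by
  -- There are finitely many vertices, so one product of minors cuts out the domain.
  have h : RegularAt (fun y => (∏ α, (minor (C.fSink α) (C.sinkM (Q y) α)).det) *
      ∏ β, (minor (C.fSource β) (C.sourceM (Q y) β)ᵀ).det) z :=
    SpaceWithFunctions.mul
      (RegularAt.prod _ fun α _ => (hQ.sinkM C α).minor.det)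
      (RegularAt.prod _ fun β _ => (hQ.sourceM C β).transpose.minor.det)
  obtain ⟨V, hV, hzV, H⟩ := SpaceWithFunctions.ne_zero h (mul_ne_zero
    (Finset.prod_ne_zero_iff.2 fun α _ => hz.1 α) (Finset.prod_ne_zero_iff.2 fun β _ => hz.2 β))
  refine ⟨V, hV, hzV, fun y hy => ?_⟩
  have := mul_ne_zero_iff.1 (H y hy)
  exact ⟨fun α => Finset.prod_ne_zero_iff.1 this.1 α (Finset.mem_univ α),
    fun β => Finset.prod_ne_zero_iff.1 this.2 β (Finset.mem_univ β)⟩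

end RegularRepAt

end QuiverVariety

/-! ### Existence of a slice chart at a point of the stratum -/

namespace QuiverVariety

open Sum Matrix SpaceWithFunctions

/-- A matrix of rank `d` factors through `d` of its rows. -/
theorem exists_rows_factorization {m n : Type*} [Fintype m] [Fintype n] {d : ℕ} (A : Matrix m n ℂ)
    (hA : A.rank = d) : ∃ (r : Fin d → m) (T : Matrix m (Fin d) ℂ),
      LinearIndependent ℂ (A.submatrix r id).row ∧ A = T * A.submatrix r id := by
  rw [rank_eq_finrank_span_row] at hA
  obtain ⟨r, hr⟩ := exists_linearIndependent_comp A.row hA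
  have hspan : Submodule.span ℂ (Set.range (A.row ∘ r)) = Submodule.span ℂ (Set.range A.row) := by
    refine Submodule.eq_of_le_of_finrank_eq
      (Submodule.span_mono (Set.range_comp_subset_range r A.row)) ?_
    rw [hA, finrank_span_eq_card hr, Fintype.card_fin]
  have : ∀ i, ∃ t : Fin d → ℂ, ∑ j, t j • (A.row ∘ r) j = A.row i := fun i =>
    (Submodule.mem_span_range_iff_exists_fun ℂ).1 (hspan ▸ Submodule.subset_span ⟨i, rfl⟩)
  choose T hT using this
  refine ⟨r, Matrix.of T, hr, Matrix.ext fun i k => ?_⟩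
  have := congrFun (hT i) k
  simpa [mul_apply] using this.symm

theorem linearIndependent_row_iff {m n : Type*} [Fintype m] {A : Matrix m n ℂ} :
    LinearIndependent ℂ A.row ↔ ∀ x : m → ℂ, x ᵥ* A = 0 → x = 0 := by
  rw [Fintype.linearIndependent_iff]
  refine forall_congr' fun x => ?_
  have : ∑ i, x i • A.row i = x ᵥ* A := by
    ext j
    simp [vecMul, dotProduct, Matrix.row]
  rw [this, funext_iff (f := x)]
  rfl

/-- A matrix with linearly independent rows has an invertible maximal minor. -/
theorem exists_equiv_det_minor_ne_zero {a b : ℕ} {J : Type*} [Fintype J] {M : Matrix (Fin a) J ℂ}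
    (hM : LinearIndependent ℂ M.row) (hcard : Fintype.card J = a + b) :
    ∃ e : Fin a ⊕ Fin b ≃ J, (minor e M).det ≠ 0 := by
  obtain ⟨c, hc⟩ := exists_det_submatrix_ne_zero M hM
  obtain ⟨e, he⟩ := exists_sum_equiv_of_injective c
    (injective_of_det_submatrix_ne_zero hc).2 hcard
  refine ⟨e, ?_⟩
  rwa [minor, show e ∘ Sum.inl = c from funext he]

variable {I₀ I₁ : Type*} {Ω : I₁ → I₀ → Type*} {v₀ : I₀ ⊕ I₁ → ℕ} {w : FrameDim (I₀ ⊕ I₁)}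
  [Fintype I₀] [Fintype I₁] [∀ β α, Fintype (Ω β α)]

/-- Every point of a stratum lies in the domain of a slice chart. -/
theorem exists_sliceChart {p : RepSpace Ω w} (hp : p ∈ Stratum Ω v₀ w) :
    ∃ wP : FrameDim (I₀ ⊕ I₁),
      (∀ i, ((wP.dim i : ℤ), (wP.dim' i : ℤ)) = ((w.dim i : ℤ), (w.dim' i : ℤ)) - Cq Ω v₀ i) ∧
      ∃ C : SliceChart Ω v₀ w wP, p ∈ C.domain := by
  have hsink : ∀ α, ∃ (r : Fin (v₀ (inl α)) → Fin (w.dim (inl α))) (T : Matrix _ _ ℂ),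
      LinearIndependent ℂ ((sinkMatrix p α).submatrix r id).row ∧
        sinkMatrix p α = T * (sinkMatrix p α).submatrix r id := fun α =>
    exists_rows_factorization _ (hp (inl α))
  have hsource : ∀ β, ∃ (r : Fin (v₀ (inr β)) → Fin (w.dim (inr β))) (T : Matrix _ _ ℂ),
      LinearIndependent ℂ ((sourceMatrix p β)ᵀ.submatrix r id).row ∧
        (sourceMatrix p β)ᵀ = T * (sourceMatrix p β)ᵀ.submatrix r id := fun β =>
    exists_rows_factorization _ ((rank_transpose _).trans (hp (inr β)))
  choose r T hr hT using hsink
  choose c S hc hS using hsource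
  have hle : ∀ i, v₀ i ≤ w.dim i := by
    rintro (α | β)
    · simpa using (hp (inl α)).symm.le.trans (rank_le_card_height (sinkMatrix p α))
    · simpa using (hp (inr β)).symm.le.trans (rank_le_card_width (sourceMatrix p β))
  -- The distinguished coordinates of `W_i` are the selected independent rows of `A_α` at sinks and
  -- the selected independent columns of `A_β` at sources.
  have he : ∀ i, ∃ e : Fin (v₀ i) ⊕ Fin (w.dim i - v₀ i) ≃ Fin (w.dim i),
      ∀ k, e (.inl k) = Sum.rec (motive := fun i => Fin (v₀ i) → Fin (w.dim i)) r c i k := by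
    intro i
    refine exists_sum_equiv_of_injective _ ?_ (by simpa using (Nat.add_sub_cancel' (hle i)).symm)
    rcases i with α | β
    · exact fun a b hab => (hr α).injective (congrArg (fun k j => sinkMatrix p α k j) hab)
    · exact fun a b hab => (hc β).injective (congrArg (fun k j => (sourceMatrix p β)ᵀ k j) hab)
  choose e he using he
  have her : ∀ α k, e (inl α) (inl k) = r α k := fun α k => he (inl α) k
  have hec : ∀ β k, e (inr β) (inl k) = c β k := fun β k => he (inr β) k
  let Msink : ∀ α, Matrix (Fin (v₀ (inl α))) (SinkIndex Ω (coreDim v₀ w) α) ℂ := fun α =>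
    (sinkMatrix p α).submatrix (r α) (Sum.map id fun x => ⟨x.1, x.2.1, c x.1 x.2.2⟩)
  let Msource : ∀ β, Matrix (SourceIndex Ω (coreDim v₀ w) β) (Fin (v₀ (inr β))) ℂ := fun β =>
    (sourceMatrix p β).submatrix (Sum.map id fun x => ⟨x.1, x.2.1, r x.1 x.2.2⟩) (c β)
  -- Passing to the selected columns `c β` loses no row rank: every column of `A_β`, hence of `y_h`,
  -- is a combination of these with coefficients `S`, so a relation among the rows of `Msink`
  -- extends to the full rows of `A_α`.
  have hMsink : ∀ α, LinearIndependent ℂ (Msink α).row := by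
    intro α
    rw [linearIndependent_row_iff]
    intro x hx
    refine linearIndependent_row_iff.1 (hr α) x (funext ?_)
    rintro (j | ⟨β, h, k⟩)
    · exact congrFun hx (inl j)
    · have h1 : ∀ i, p.2.2 β α h i k = ∑ j, p.2.2 β α h i (c β j) * S β k j := by
        intro i
        have := congrFun (congrFun (hS β) k) (inr ⟨α, h, i⟩)
        rw [mul_apply] at this
        simp only [mul_comm _ (S β k _)]
        exact this
      have h2 : ∀ j, ∑ i, x i * p.2.2 β α h (r α i) (c β j) = 0 := fun j =>
        congrFun hx (inr ⟨β, h, j⟩)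
      change ∑ i, x i * p.2.2 β α h (r α i) k = 0
      simp only [h1, Finset.mul_sum, ← mul_assoc]
      rw [Finset.sum_comm]
      simp only [← Finset.sum_mul, h2, zero_mul, Finset.sum_const_zero]
  have hMsource : ∀ β, LinearIndependent ℂ (Msource β)ᵀ.row := by
    intro β
    rw [linearIndependent_row_iff]
    intro x hx
    refine linearIndependent_row_iff.1 (hc β) x (funext ?_)
    rintro (j | ⟨α, h, k⟩)
    · exact congrFun hx (inl j)
    · have h1 : ∀ i, p.2.2 β α h k i = ∑ j, p.2.2 β α h (r α j) i * T α k j := by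
        intro i
        have := congrFun (congrFun (hT α) k) (inr ⟨β, h, i⟩)
        rw [mul_apply] at this
        simp only [mul_comm _ (T α k _)]
        exact this
      have h2 : ∀ j, ∑ i, x i * p.2.2 β α h (r α j) (c β i) = 0 := fun j =>
        congrFun hx (inr ⟨α, h, j⟩)
      change ∑ i, x i * p.2.2 β α h k (c β i) = 0
      simp only [h1, Finset.mul_sum, ← mul_assoc]
      rw [Finset.sum_comm]
      simp only [← Finset.sum_mul, h2, zero_mul, Finset.sum_const_zero]
  -- Independent rows are at most as many as the columns; this is the nonnegativity of the primed
  -- entries of `w - C_q v₀` at sinks.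
  have hsinkle : ∀ α, v₀ (inl α) ≤ Fintype.card (SinkIndex Ω (coreDim v₀ w) α) := fun α => by
    have := rank_le_card_width (Msink α)
    rwa [(hMsink α).rank_matrix, Fintype.card_fin] at this
  have hsourcele : ∀ β, v₀ (inr β) ≤ Fintype.card (SourceIndex Ω (coreDim v₀ w) β) := fun β => by
    have := rank_le_card_width (Msource β)ᵀ
    rwa [(hMsource β).rank_matrix, Fintype.card_fin] at this
  choose fSink hfSink using fun α => exists_equiv_det_minor_ne_zero (hMsink α)
    (Nat.add_sub_cancel' (hsinkle α)).symm
  choose fSource hfSource using fun β => exists_equiv_det_minor_ne_zero (hMsource β)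
    (Nat.add_sub_cancel' (hsourcele β)).symm
  refine ⟨⟨fun i => w.dim i - v₀ i, Sum.rec
    (fun α => Fintype.card (SinkIndex Ω (coreDim v₀ w) α) - v₀ (inl α))
    (fun β => Fintype.card (SourceIndex Ω (coreDim v₀ w) β) - v₀ (inr β))⟩, ?_,
    ⟨e, fSink, fSource⟩, ?_, ?_⟩
  -- The truncated subtractions are exact by `hle`, `hsinkle` and `hsourcele`, and the index sets
  -- have `w'_i` plus the sum of the `v₀` over adjacent arrows as cardinality.
  · rintro (α | β)
    · simp only [Cq, Prod.mk_sub_mk, Nat.cast_sub (hle _), Nat.cast_sub (hsinkle _)]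
      simp only [Fintype.card_sum, Fintype.card_sigma, Fintype.card_fin, Nat.cast_add, Nat.cast_sum]
      congr 1
      ring
    · simp only [Cq, Prod.mk_sub_mk, Nat.cast_sub (hle _), Nat.cast_sub (hsourcele _)]
      simp only [Fintype.card_sum, Fintype.card_sigma, Fintype.card_fin, Nat.cast_add, Nat.cast_sum]
      congr 1
      ring
  · intro α
    convert hfSink α using 3
    ext i (j | ⟨β, h, j⟩) <;> simp [SliceChart.sinkM, SliceChart.sinkEquiv, Msink, her, hec]
  · intro β
    convert hfSource β using 3
    ext i (j | ⟨α, h, j⟩) <;> simp [SliceChart.sourceM, SliceChart.sourceEquiv, Msource, her, hec]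

end QuiverVariety

/-! ### The product decompositions of the affine and the nonsingular variety -/

namespace QuiverVariety

open Sum Matrix SpaceWithFunctions

theorem rank_eq_zero_iff {m n : Type*} [Finite m] [Fintype n] {A : Matrix m n ℂ} :
    A.rank = 0 ↔ A = 0 := by
  refine ⟨fun h => ?_, fun h => by rw [h, rank_zero]⟩
  have h1 : A.mulVecLin = 0 := LinearMap.range_eq_bot.1 (Submodule.finrank_eq_zero.1 h)
  classical
  ext i j
  have := congrFun (LinearMap.congr_fun h1 (Pi.single j 1)) i
  simpa using this

variable {I₀ I₁ : Type*} {Ω : I₁ → I₀ → Type*} {v v₀ : I₀ ⊕ I₁ → ℕ} {w wP : FrameDim (I₀ ⊕ I₁)}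
  [Fintype I₀] [Fintype I₁] [∀ β α, Fintype (Ω β α)]

theorem rankA_eq_zero_iff {q : RepSpace Ω w} : (∀ i, rankA q i = 0) ↔ q = 0 := by
  constructor
  · intro h
    have h1 : ∀ α, sinkMatrix q α = 0 := fun α => rank_eq_zero_iff.1 (h (inl α))
    have h2 : ∀ β, sourceMatrix q β = 0 := fun β => rank_eq_zero_iff.1 (h (inr β))
    refine Prod.ext (funext fun α => ?_) (Prod.ext (funext fun β => ?_) (funext fun β => funext
      fun α => funext fun h => ?_))
    · ext i j
      exact congrFun (congrFun (h1 α) i) (inl j)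
    · ext i j
      exact congrFun (congrFun (h2 β) (inl i)) j
    · ext i j
      exact congrFun (congrFun (h1 α) i) (inr ⟨β, h, j⟩)
  · rintro rfl (α | β)
    · refine rank_eq_zero_iff.2 ?_
      ext i (j | ⟨β, h, j⟩) <;> rfl
    · refine rank_eq_zero_iff.2 ?_
      ext (i | ⟨β, h, i⟩) j <;> rfl

theorem sinkMatrix_smul (c : ℂ) (q : RepSpace Ω w) (α : I₀) :
    sinkMatrix (c • q) α = c • sinkMatrix q α := by
  ext i (j | ⟨β, h, j⟩) <;> rfl

theorem sourceMatrix_smul (c : ℂ) (q : RepSpace Ω w) (β : I₁) :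
    sourceMatrix (c • q) β = c • sourceMatrix q β := by
  ext (i | ⟨β, h, i⟩) j <;> rfl

theorem rankA_smul {c : ℂ} (hc : c ≠ 0) (q : RepSpace Ω w) (i : I₀ ⊕ I₁) :
    rankA (c • q) i = rankA q i := by
  rcases i with α | β
  · exact (congrArg Matrix.rank (sinkMatrix_smul c q α)).trans
      (rank_smul_of_mem_nonZeroDivisors _ (mem_nonZeroDivisors_of_ne_zero hc))
  · exact (congrArg Matrix.rank (sourceMatrix_smul c q β)).trans
      (rank_smul_of_mem_nonZeroDivisors _ (mem_nonZeroDivisors_of_ne_zero hc))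

namespace SliceChart

variable (C : SliceChart Ω v₀ w wP) {q : RepSpace Ω w}

theorem smul_mem_domain {c : ℂ} (hc : c ≠ 0) (hq : q ∈ C.domain) : c • q ∈ C.domain := by
  refine ⟨fun α => ?_, fun β => ?_⟩
  · have : minor (C.fSink α) (C.sinkM (c • q) α) = c • minor (C.fSink α) (C.sinkM q α) := by
      rw [sinkM, sinkMatrix_smul]; rfl
    rw [this, det_smul]
    exact mul_ne_zero (pow_ne_zero _ hc) (hq.1 α)
  · have : minor (C.fSource β) (C.sourceM (c • q) β)ᵀ =
        c • minor (C.fSource β) (C.sourceM q β)ᵀ := by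
      rw [sourceM, sourceMatrix_smul]; rfl
    rw [this, det_smul]
    exact mul_ne_zero (pow_ne_zero _ hc) (hq.2 β)

/-- By the rank formula, membership in the stratum says that all ranks of the slice component
vanish, that is, that this component is zero. -/
theorem mem_stratum_iff (hq : q ∈ C.domain) : q ∈ Stratum Ω v₀ w ↔ C.perp q = 0 := by
  rw [← rankA_eq_zero_iff]
  refine forall_congr' fun i => ?_
  rw [C.rankA_eq hq]
  omega

theorem perp_mem_E (hq : q ∈ C.domain) (h : q ∈ E Ω v w) : C.perp q ∈ E Ω (v - v₀) wP := by
  intro i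
  have := h i
  rw [C.rankA_eq hq] at this
  exact Nat.le_sub_of_add_le' this

theorem base_mem_stratum (hq : q ∈ C.domain) : C.base q ∈ Stratum Ω v₀ w :=
  (C.mem_stratum_iff (C.base_mem_domain.2 hq)).2 (C.perp_base q)

theorem rankA_glue (hq : q ∈ C.domain) (hq₀ : q ∈ Stratum Ω v₀ w) (r : RepSpace Ω wP)
    (i : I₀ ⊕ I₁) : rankA (C.glue q r) i = v₀ i + rankA r i := by
  rw [C.rankA_eq (C.glue_mem_domain.2 hq), C.perp_glue ((C.mem_stratum_iff hq).1 hq₀)]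

theorem glue_mem_E (hv : v₀ ≤ v) (hq : q ∈ C.domain) (hq₀ : q ∈ Stratum Ω v₀ w)
    {r : RepSpace Ω wP} (hr : r ∈ E Ω (v - v₀) wP) : C.glue q r ∈ E Ω v w := by
  intro i
  rw [C.rankA_glue hq hq₀]
  exact (Nat.add_le_add_left (hr i) _).trans (Nat.add_sub_cancel' (hv i)).le

variable (v)

/-- The open subset of `E_{v,w}` defined by a slice chart. -/
def openE : Set (RepSpace Ω w) := E Ω v w ∩ C.domain

/-- The open subset of the stratum defined by a slice chart. -/
def openStratum : Set (RepSpace Ω w) := Stratum Ω v₀ w ∩ C.domain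

variable {v}

theorem perp_eq_zero_of_mem (hq : q ∈ C.openStratum) : C.perp q = 0 :=
  (C.mem_stratum_iff hq.2).1 hq.1

/-- The local product decomposition of `E_{v,w}`. -/
noncomputable def isoE (hv : v₀ ≤ v) : Iso (C.openE v) (C.openStratum × E Ω (v - v₀) wP) where
  toFun q := (⟨C.base q, C.base_mem_stratum q.2.2, C.base_mem_domain.2 q.2.2⟩,
    ⟨C.perp q, C.perp_mem_E q.2.2 q.2.1⟩)
  invFun r := ⟨C.glue r.1 r.2, C.glue_mem_E hv r.1.2.2 r.1.2.1 r.2.2,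
    C.glue_mem_domain.2 r.1.2.2⟩
  left_inv q := Subtype.ext (C.glue_base_perp q)
  right_inv r := Prod.ext (Subtype.ext (C.base_glue (C.perp_eq_zero_of_mem r.1.2)))
    (Subtype.ext (C.perp_glue (C.perp_eq_zero_of_mem r.1.2)))
  isMorphism_toFun := isMorphism_of_morphAt fun q => by
    have hq : RegularRepAt (fun q : C.openE v => (q : RepSpace Ω w)) q := .of_morphAt (.val q)
    exact .prodMk (.of_val (hq.base q.2.2).morphAt) (.of_val (hq.perp q.2.2).morphAt)
  isMorphism_invFun := isMorphism_of_morphAt fun r => by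
    have h₁ : RegularRepAt
        (fun r : C.openStratum × E Ω (v - v₀) wP => (r.1 : RepSpace Ω w)) r :=
      .of_morphAt ((MorphAt.val r.1).comp (MorphAt.fst r))
    have h₂ : RegularRepAt
        (fun r : C.openStratum × E Ω (v - v₀) wP => (r.2 : RepSpace Ω wP)) r :=
      .of_morphAt ((MorphAt.val r.2).comp (MorphAt.snd r))
    exact .of_val (h₁.glue r.1.2.2 h₂).morphAt

theorem range_sinkKer_le_space {z : RepSpace Ω w × GrProd Ω v w} (hz : z ∈ Ftilde Ω v w)
    (hq : z.1 ∈ C.domain) (α : I₀) :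
    LinearMap.range (C.sinkKer z.1 α).mulVecLin ≤ (z.2.1 α).space :=
  (C.range_sinkKer_le hq α).trans (hz.2.1 α)

theorem range_sourceKer_le_space {z : RepSpace Ω w × GrProd Ω v w} (hz : z ∈ Ftilde Ω v w)
    (β : I₁) : LinearMap.range (C.sourceKer z.1 β).mulVecLin ≤ (z.2.2 β).space :=
  (C.range_sourceKer_le z.1 β).trans (hz.2.2 β)

/-- The images of the subspaces `X_i` in the slice. -/
noncomputable def grPerp {z : RepSpace Ω w × GrProd Ω v w} (hz : z ∈ Ftilde Ω v w)
    (hq : z.1 ∈ C.domain) : GrProd Ω (v - v₀) wP :=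
  (fun α => ⟨(z.2.1 α).space.map (C.sinkRed z.1 α).mulVecLin, by
      have := (C.splitExact_sink z.1 α).finrank_map (C.range_sinkKer_le_space hz hq α)
      rw [(z.2.1 α).finrank_eq, Fintype.card_fin] at this
      exact (Nat.sub_eq_of_eq_add' this.symm).symm⟩,
    fun β => ⟨(z.2.2 β).space.map (C.sourceRed z.1 β).mulVecLin, by
      classical
      have := (C.splitExact_source hq β).finrank_map (C.range_sourceKer_le_space hz β)
      rw [(z.2.2 β).finrank_eq, Fintype.card_fin] at this
      exact (Nat.sub_eq_of_eq_add' this.symm).symm⟩)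

/-- For `ξ` in `X_β`, the `h`-component of its reduction differs from the reduction of its
`h`-component by an element of the image of the slice matrix, which lies in the reduced `X_α`. -/
theorem perp_grPerp_mem {z : RepSpace Ω w × GrProd Ω v w} (hz : z ∈ Ftilde Ω v w)
    (hq : z.1 ∈ C.domain) : (C.perp z.1, C.grPerp hz hq) ∈ Ftilde Ω (v - v₀) wP := by
  have hα : ∀ α, LinearMap.range (sinkMatrix (C.perp z.1) α).mulVecLin ≤
      (z.2.1 α).space.map (C.sinkRed z.1 α).mulVecLin := fun α => by
    rw [← C.map_sinkRed_range hq]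
    exact Submodule.map_mono (hz.2.1 α)
  refine ⟨?_, hα, fun β => ?_⟩
  · rintro β _ ⟨ξ, hξ, rfl⟩ α h
    have h1 : C.sinkRed z.1 α *ᵥ (fun k => ξ (inr ⟨α, h, k⟩)) ∈
        (z.2.1 α).space.map (C.sinkRed z.1 α).mulVecLin := ⟨_, hz.1 β ξ hξ α h, rfl⟩
    have h2 := hα α (C.sinkRed_mulVec_sub_mem hq h ξ)
    have h3 := Submodule.sub_mem _ h1 h2
    rwa [sub_sub_cancel] at h3
  · change _ ≤ (z.2.2 β).space.map (C.sourceRed z.1 β).mulVecLin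
    rw [← C.map_sourceRed_range hq]
    exact Submodule.map_mono (hz.2.2 β)

/-- The preimages of subspaces of the slice. -/
noncomputable def grGlue (hv : v₀ ≤ v) (hq : q ∈ C.domain) (Y : GrProd Ω (v - v₀) wP) :
    GrProd Ω v w :=
  (fun α => ⟨(Y.1 α).space.comap (C.sinkRed q α).mulVecLin, by
      rw [(C.splitExact_sink q α).finrank_comap, (Y.1 α).finrank_eq, Fintype.card_fin]
      exact Nat.add_sub_cancel' (hv _)⟩,
    fun β => ⟨(Y.2 β).space.comap (C.sourceRed q β).mulVecLin, by
      classical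
      rw [(C.splitExact_source hq β).finrank_comap, (Y.2 β).finrank_eq, Fintype.card_fin]
      exact Nat.add_sub_cancel' (hv _)⟩)

/-- The incidence argument of `perp_grPerp_mem` run backwards: the same discrepancy lies in `Y_α`.
-/
theorem grGlue_mem (hv : v₀ ≤ v) (hq : q ∈ C.domain) {Y : GrProd Ω (v - v₀) wP}
    (hY : (C.perp q, Y) ∈ Ftilde Ω (v - v₀) wP) : (q, C.grGlue hv hq Y) ∈ Ftilde Ω v w := by
  refine ⟨?_, fun α => ?_, fun β => ?_⟩
  · intro β ξ hξ α h
    have h1 : (fun k => (C.sourceRed q β *ᵥ ξ) (inr ⟨α, h, k⟩)) ∈ (Y.1 α).space :=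
      hY.1 β _ hξ α h
    have h2 := hY.2.1 α (C.sinkRed_mulVec_sub_mem hq h ξ)
    have h3 := Submodule.add_mem _ h2 h1
    rwa [sub_add_cancel] at h3
  · change _ ≤ (Y.1 α).space.comap (C.sinkRed q α).mulVecLin
    rw [← Submodule.map_le_iff_le_comap, C.map_sinkRed_range hq]
    exact hY.2.1 α
  · change _ ≤ (Y.2 β).space.comap (C.sourceRed q β).mulVecLin
    rw [← Submodule.map_le_iff_le_comap, C.map_sourceRed_range hq]
    exact hY.2.2 β

theorem grGlue_grPerp (hv : v₀ ≤ v) {z : RepSpace Ω w × GrProd Ω v w} (hz : z ∈ Ftilde Ω v w)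
    (hq : z.1 ∈ C.domain) : C.grGlue hv hq (C.grPerp hz hq) = z.2 := by
  classical
  refine Prod.ext (funext fun α => Gr.ext ?_) (funext fun β => Gr.ext ?_)
  · exact (C.splitExact_sink z.1 α).comap_map (C.range_sinkKer_le_space hz hq α)
  · exact (C.splitExact_source hq β).comap_map (C.range_sourceKer_le_space hz β)

theorem grPerp_grGlue (hv : v₀ ≤ v) (hq : q ∈ C.domain) {Y : GrProd Ω (v - v₀) wP}
    (hY : (C.perp q, Y) ∈ Ftilde Ω (v - v₀) wP) :
    C.grPerp (C.grGlue_mem hv hq hY) hq = Y := by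
  classical
  refine Prod.ext (funext fun α => Gr.ext ?_) (funext fun β => Gr.ext ?_)
  · exact (C.splitExact_sink q α).map_comap _
  · exact (C.splitExact_source hq β).map_comap _

/-- The construction takes a proof of `q ∈ C.domain`, so equal representations are exchanged through
this lemma instead of by rewriting. -/
theorem grGlue_congr (hv : v₀ ≤ v) {q' : RepSpace Ω w} (h : q = q') (hq : q ∈ C.domain)
    (hq' : q' ∈ C.domain) (Y : GrProd Ω (v - v₀) wP) :
    C.grGlue hv hq Y = C.grGlue hv hq' Y := by
  subst h
  rfl

/-- The decomposition of a point of `F̃_{v,w}` into its component in the stratum and its component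
along the slice. -/
noncomputable def redFtilde (z : {z : Ftilde Ω v w // (proj z : RepSpace Ω w) ∈ C.openE v}) :
    C.openStratum × Ftilde Ω (v - v₀) wP :=
  (⟨C.base z.1.1.1, C.base_mem_stratum z.2.2, C.base_mem_domain.2 z.2.2⟩,
    ⟨(C.perp z.1.1.1, C.grPerp z.1.2 z.2.2), C.perp_grPerp_mem z.1.2 z.2.2⟩)

theorem perp_glue_mem (r : C.openStratum × Ftilde Ω (v - v₀) wP) :
    (C.perp (C.glue r.1.1 r.2.1.1), r.2.1.2) ∈ Ftilde Ω (v - v₀) wP := by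
  rw [C.perp_glue (C.perp_eq_zero_of_mem r.1.2)]
  exact r.2.2

/-- The point of `F̃_{v,w}` with given components in the stratum and along the slice. -/
noncomputable def glueFtilde (hv : v₀ ≤ v) (r : C.openStratum × Ftilde Ω (v - v₀) wP) :
    {z : Ftilde Ω v w // (proj z : RepSpace Ω w) ∈ C.openE v} :=
  ⟨⟨(C.glue r.1.1 r.2.1.1, C.grGlue hv (C.glue_mem_domain.2 r.1.2.2) r.2.1.2),
    C.grGlue_mem hv (C.glue_mem_domain.2 r.1.2.2) (C.perp_glue_mem r)⟩,
    C.glue_mem_E hv r.1.2.2 r.1.2.1 (proj r.2).2, C.glue_mem_domain.2 r.1.2.2⟩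

theorem morphAt_redFtilde (z : {z : Ftilde Ω v w // (proj z : RepSpace Ω w) ∈ C.openE v}) :
    MorphAt C.redFtilde z := by
  classical
  have hval : MorphAt (fun z : {z : Ftilde Ω v w // (proj z : RepSpace Ω w) ∈ C.openE v} =>
      z.1.1) z := (MorphAt.val z.1).comp (MorphAt.val z)
  have hq : RegularRepAt (fun z : {z : Ftilde Ω v w // (proj z : RepSpace Ω w) ∈ C.openE v} =>
      z.1.1.1) z := .of_morphAt hval.fst_comp
  have hX : MorphAt (fun z : {z : Ftilde Ω v w // (proj z : RepSpace Ω w) ∈ C.openE v} =>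
      z.1.1.2) z := hval.snd_comp
  have hα : ∀ α, MorphAt (fun z => (C.redFtilde z).2.1.2.1 α) z := fun α =>
    MorphAt.gr_map ((MorphAt.apply α _).comp hX.fst_comp)
      (hq.sinkRed z.2.2 α) fun _ => rfl
  have hβ : ∀ β, MorphAt (fun z => (C.redFtilde z).2.1.2.2 β) z := fun β =>
    MorphAt.gr_map ((MorphAt.apply β _).comp hX.snd_comp)
      (hq.sourceRed z.2.2 β) fun _ => rfl
  exact .prodMk (.of_val (hq.base z.2.2).morphAt) (.of_val (.prodMk (hq.perp z.2.2).morphAt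
    (.prodMk (.piMk hα) (.piMk hβ))))

theorem morphAt_glueFtilde (hv : v₀ ≤ v) (r : C.openStratum × Ftilde Ω (v - v₀) wP) :
    MorphAt (C.glueFtilde hv) r := by
  classical
  have h₁ : RegularRepAt
      (fun r : C.openStratum × Ftilde Ω (v - v₀) wP => (r.1 : RepSpace Ω w)) r :=
    .of_morphAt ((MorphAt.val r.1).comp (MorphAt.fst r))
  have hval : MorphAt (fun r : C.openStratum × Ftilde Ω (v - v₀) wP => r.2.1) r :=
    (MorphAt.val r.2).comp (MorphAt.snd r)
  have h₂ : RegularRepAt (fun r : C.openStratum × Ftilde Ω (v - v₀) wP => r.2.1.1) r :=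
    .of_morphAt hval.fst_comp
  have hY : MorphAt (fun r : C.openStratum × Ftilde Ω (v - v₀) wP => r.2.1.2) r :=
    hval.snd_comp
  have hq := h₁.glue r.1.2.2 h₂
  have hr : C.glue r.1.1 r.2.1.1 ∈ C.domain := C.glue_mem_domain.2 r.1.2.2
  have hα : ∀ α, MorphAt (fun r => (C.glueFtilde hv r).1.1.2.1 α) r := fun α =>
    MorphAt.gr_comap ((MorphAt.apply α _).comp hY.fst_comp)
      (hq.sinkKer hr α) (.const _) (fun _ => C.splitExact_sink _ α) fun _ => rfl
  have hβ : ∀ β, MorphAt (fun r => (C.glueFtilde hv r).1.1.2.2 β) r := fun β =>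
    MorphAt.gr_comap ((MorphAt.apply β _).comp hY.snd_comp)
      (hq.sourceKer β) (hq.sourceLift hr β)
      (fun y => C.splitExact_source (C.glue_mem_domain.2 y.1.2.2) β) fun _ => rfl
  exact .of_val (.of_val (.prodMk hq.morphAt (.prodMk (.piMk hα) (.piMk hβ))))

/-- The local product decomposition of `F̃_{v,w}`. -/
noncomputable def isoFtilde (hv : v₀ ≤ v) :
    Iso {z : Ftilde Ω v w // (proj z : RepSpace Ω w) ∈ C.openE v}
      (C.openStratum × Ftilde Ω (v - v₀) wP) where
  toFun := C.redFtilde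
  invFun := C.glueFtilde hv
  left_inv z := by
    refine Subtype.ext (Subtype.ext (Prod.ext (C.glue_base_perp z.1.1.1) ?_))
    -- Replace the reglued representation by the original one; then preimages undo images because
    -- each `X_i` contains the kernel of the reduction.
    exact (C.grGlue_congr hv (C.glue_base_perp z.1.1.1)
      (C.glue_mem_domain.2 (C.base_mem_domain.2 z.2.2)) z.2.2 _).trans (C.grGlue_grPerp hv z.1.2 z.2.2)
  right_inv r := by
    have h₀ := C.perp_eq_zero_of_mem r.1.2
    exact Prod.ext (Subtype.ext (C.base_glue h₀)) (Subtype.ext (Prod.ext (C.perp_glue h₀)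
      (C.grPerp_grGlue hv (C.glue_mem_domain.2 r.1.2.2) (C.perp_glue_mem r))))
  isMorphism_toFun := isMorphism_of_morphAt C.morphAt_redFtilde
  isMorphism_invFun := isMorphism_of_morphAt (C.morphAt_glueFtilde hv)

/-- Arbitrary `S` covers both `E_{v,w}` and the stratum. -/
theorem isZariskiOpen_domain (S : Set (RepSpace Ω w)) :
    IsZariskiOpen {q : S | (q : RepSpace Ω w) ∈ S ∩ C.domain} := by
  refine isZariskiOpen_iff_forall.2 fun q hq => ?_
  have h : RegularRepAt (fun q : S => (q : RepSpace Ω w)) q := .of_morphAt (.val q)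
  obtain ⟨V, hV, hqV, H⟩ := h.eventually_mem_domain hq.2
  exact ⟨V, hV, hqV, fun y hy => ⟨y.2, H y hy⟩⟩

end SliceChart

end QuiverVariety

/-! ### The transversal slice theorem -/

open QuiverVariety SpaceWithFunctions in
theorem lemma4p3 {I₀ I₁ : Type*} [Fintype I₀] [Fintype I₁] (Ω : I₁ → I₀ → Type*)
    [∀ β α, Fintype (Ω β α)] (v v₀ : I₀ ⊕ I₁ → ℕ) (w : FrameDim (I₀ ⊕ I₁))
    (p : RepSpace Ω w) (hp : p ∈ E Ω v w) (hp₀ : p ∈ Stratum Ω v₀ w) :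
    v₀ ≤ v ∧
    ∃ wPerp : FrameDim (I₀ ⊕ I₁),
      (∀ i, ((wPerp.dim i : ℤ), (wPerp.dim' i : ℤ)) = ((w.dim i : ℤ), (w.dim' i : ℤ)) - Cq Ω v₀ i) ∧
    ∃ U U₀ : Set (RepSpace Ω w),
      (U ⊆ E Ω v w ∧ IsZariskiOpen {q : E Ω v w | (q : RepSpace Ω w) ∈ U}) ∧
      (U₀ ⊆ Stratum Ω v₀ w ∧ IsZariskiOpen {q : Stratum Ω v₀ w | (q : RepSpace Ω w) ∈ U₀}) ∧
      (∀ c : ℂ, c ≠ 0 → ∀ q ∈ U, c • q ∈ U) ∧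
      (∀ c : ℂ, c ≠ 0 → ∀ q ∈ U₀, c • q ∈ U₀) ∧
    ∃ (hU : p ∈ U) (hU₀ : p ∈ U₀)
      (φ : Iso {z : Ftilde Ω v w // (proj z : RepSpace Ω w) ∈ U} (U₀ × Ftilde Ω (v - v₀) wPerp))
      (ψ : Iso U (U₀ × E Ω (v - v₀) wPerp)),
      (∀ z, ψ.toFun ⟨proj z.1, z.2⟩ = ((φ.toFun z).1, proj (φ.toFun z).2)) ∧
      ((ψ.toFun ⟨p, hU⟩).1 = ⟨p, hU₀⟩ ∧ ((ψ.toFun ⟨p, hU⟩).2 : RepSpace Ω wPerp) = 0) ∧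
      ∀ u : I₀ ⊕ I₁ → ℕ, v₀ ≤ u → u ≤ v →
        ψ.toFun '' {q : U | (q : RepSpace Ω w) ∈ Stratum Ω u w} =
          {r : U₀ × E Ω (v - v₀) wPerp | (r.2 : RepSpace Ω wPerp) ∈ Stratum Ω (u - v₀) wPerp} := by
  have hv : v₀ ≤ v := fun i => (hp₀ i).symm.le.trans (hp i)
  obtain ⟨wPerp, hw, C, hC⟩ := exists_sliceChart hp₀
  have hperp : C.perp p = 0 := C.perp_eq_zero_of_mem ⟨hp₀, hC⟩
  refine ⟨hv, wPerp, hw, C.openE v, C.openStratum, ⟨Set.inter_subset_left,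
    C.isZariskiOpen_domain _⟩, ⟨Set.inter_subset_left, C.isZariskiOpen_domain _⟩,
    fun c hc q hq => ⟨fun i => (rankA_smul hc q i).le.trans (hq.1 i), C.smul_mem_domain hc hq.2⟩,
    fun c hc q hq => ⟨fun i => (rankA_smul hc q i).trans (hq.1 i), C.smul_mem_domain hc hq.2⟩,
    -- The square commutes by definition: both isomorphisms act on the representation through `base`
    -- and `perp`.
    ⟨hp, hC⟩, ⟨hp₀, hC⟩, C.isoFtilde hv, C.isoE hv, fun z => rfl, ⟨?_, hperp⟩, ?_⟩
  · refine Subtype.ext ?_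
    exact C.base_eq_self hperp
  -- Both inclusions are the rank formula, applied to `q` and to the glued representation; `v₀ ≤ u`
  -- makes the truncated difference `u - v₀` exact.
  · intro u hu huv
    ext r
    constructor
    · rintro ⟨q, hq, rfl⟩ i
      have := hq i
      rw [C.rankA_eq q.2.2] at this
      exact (Nat.sub_eq_of_eq_add' this.symm).symm
    · intro hr
      refine ⟨(C.isoE hv).invFun r, fun i => ?_, (C.isoE hv).right_inv r⟩
      change rankA (C.glue r.1 r.2) i = u i
      rw [C.rankA_glue r.1.2.2 r.1.2.1, hr i]
      exact Nat.add_sub_cancel' (hu i)
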